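/- Let $\mathfrak{su}(2)$ be the Lie algebra of traceless skew-Hermitian $2\times 2$ matrices and let $\langle\cdot,\cdot\rangle$ be the Killing form of $\mathfrak{su}(2)$ or any fixed nonzero real multiple of it. Put $\Phi(a_1,a_2,a_3)=\langle a_1,[a_2,a_3]\rangle$ on $\mathfrak{su}(2)^3$ and $\mathfrak{su}(2)^3_\star=\{\Phi\ne 0\}$, $\mathfrak{su}(2)^3_\pm=\{\pm\Phi>0\}$. Write $l^j_\xi(a_1,a_2,a_3)=\langle\xi,a_j\rangle$ and $$A=\tfrac1\Phi\big([a_1,a_2]\otimes[a_1,a_2]+[a_2,a_3]\otimes[a_2,a_3]+[a_3,a_1]\otimes[a_3,a_1]\big),$$ and let $A_{\xi,\zeta}$ be the contraction of $A$ with $\xi,\zeta$. Let $\pi_1$ be the bivector field on $\mathfrak{su}(2)^3_\star$ with $$\{l^1_\xi,l^1_\zeta\}=l^1_{[\xi,\zeta]},\quad \{l^1_\xi,l^2_\zeta\}=\{l^2_\xi,l^1_\zeta\}=l^2_{[\xi,\zeta]},\quad \{l^1_\xi,l^3_\zeta\}=\{l^3_\xi,l^1_\zeta\}=l^3_{[\xi,\zeta]},$$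 $$\{l^2_\xi,l^2_\zeta\}=\{l^3_\xi,l^3_\zeta\}=-l^1_{[\xi,\zeta]},\quad \{l^2_\xi,l^3_\zeta\}=-\{l^3_\xi,l^2_\zeta\}=A_{\xi,\zeta},$$ and put $\pi_2=\sigma_*\pi_1$, $\pi_3=\sigma_*\pi_2$ with $\sigma(a_1,a_2,a_3)=(a_3,a_1,a_2)$; write $\beta(\pi_i^\sharp\alpha)=\pi_i(\alpha,\beta)$. A leaf is a symplectic leaf of $\pi_1$, that is, a leaf of the distribution $\mathcal D=\pi_1^\sharp(T^*\mathfrak{su}(2)^3_\star)$. It carries the forms $\omega_1,\omega_2,\omega_3$ given by $\omega_i(\pi_i^\sharp\alpha,v)=\alpha(v)$ for tangent vectors $v$, and the pseudo-Riemannian metric $g^\flat=\omega_3^\flat(\omega_1^\flat)^{-1}\omega_2^\flat$, where $\omega_i^\flat(u)=\omega_i(u,\cdot)$. For $q,r\ge 0$ let $$N_{q,r}=\{a\in\mathfrak{su}(2)^3_\star : \Phi(a)<0,\ \langle a_i,a_j\rangle=0\ (i\ne j),\ \langle a_1,a_1\rangle-\langle a_2,a_2\rangle=q,\ \langle a_2,a_2\rangle-\langle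 a_3,a_3\rangle=r\}.$$ **Theorem.** Each $N_{q,r}$ with $q,r\ge0$ is a leaf. Every leaf $L$ (as well as each $N_{q,r}$) is an embedded submanifold with tangent spaces $\mathcal D$, and every leaf is contained in $\mathfrak{su}(2)^3_-$ or in $\mathfrak{su}(2)^3_+$. Moreover: - The metric on $L$ is positive-definite if and only if $L\subset\mathfrak{su}(2)^3_-$. In this case there are $q,r\ge 0$ and an isomorphism of hyperkähler structures between $L$ and $N_{q,r}$, that is, a diffeomorphism $F\colon L\to N_{q,r}$ and an $O\in\mathrm{SO}(3)$ with $F^*(\omega_1,\omega_2,\omega_3)=(\omega_1,\omega_2,\omega_3)\,O$. - The metric on $L$ is negative-definite if and only if $L\subset\mathfrak{su}(2)^3_+$. In this case there are $q',r'\ge 0$ and an anti-isomorphism between $L$ and $N_{q',r'}$, that is, a diffeomorphism $F\colon L\to N_{q',r'}$ and an $O'\in\mathrm{O}(3)$ with $\det O'=-1$ and $F^*(\omega_1,\omega_2,\omega_3)=(\omega_1,\omega_2,\omega_3)\,O'$. -/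

import Mathlib

open scoped ContDiff Topology

noncomputable section

namespace HyperLie

attribute [local instance] LieRing.ofAssociativeRing

/-! ### The Lie algebra `su(2)` and the space `su(2)³` -/

/-- The real Lie algebra `su(2)` of traceless skew-Hermitian complex `2 × 2` matrices, with the
commutator as bracket. -/
def su2 : LieSubalgebra ℝ (Matrix (Fin 2) (Fin 2) ℂ) where
  carrier := {x | x.conjTranspose = -x ∧ x.trace = 0}
  add_mem' := by
    rintro x y ⟨hx, hx'⟩ ⟨hy, hy'⟩
    refine ⟨?_, ?_⟩
    · rw [Matrix.conjTranspose_add, hx, hy, neg_add]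
    · rw [Matrix.trace_add, hx', hy', add_zero]
  zero_mem' := by simp
  smul_mem' := by
    rintro c x ⟨hx, hx'⟩
    refine ⟨?_, ?_⟩
    · rw [Matrix.conjTranspose_smul, hx, smul_neg, star_trivial]
    · rw [Matrix.trace_smul, hx', smul_zero]
  lie_mem' := by
    rintro x y ⟨hx, _⟩ ⟨hy, _⟩
    refine ⟨?_, ?_⟩
    · rw [Ring.lie_def, Matrix.conjTranspose_sub, Matrix.conjTranspose_mul,
        Matrix.conjTranspose_mul, hx, hy]
      simp
    · rw [Ring.lie_def, Matrix.trace_sub, Matrix.trace_mul_comm, sub_self]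

/-- The Frobenius norm on `su(2)`. It only serves to speak of derivatives: the space is
finite-dimensional, so any other norm gives the same smooth maps. -/
instance : NormedAddCommGroup su2 :=
  letI : NormedAddCommGroup (Matrix (Fin 2) (Fin 2) ℂ) := Matrix.frobeniusNormedAddCommGroup
  inferInstanceAs (NormedAddCommGroup su2.toSubmodule)

instance : NormedSpace ℝ su2 :=
  letI : NormedAddCommGroup (Matrix (Fin 2) (Fin 2) ℂ) := Matrix.frobeniusNormedAddCommGroup
  letI : NormedSpace ℝ (Matrix (Fin 2) (Fin 2) ℂ) := Matrix.frobeniusNormedSpace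
  inferInstanceAs (NormedSpace ℝ su2.toSubmodule)

/-- The space `su(2)³`; a point `a` is the triple `(a 0, a 1, a 2)`. -/
abbrev Su2Cubed : Type := Fin 3 → su2

/-- The invariant form `⟨x, y⟩` on `su(2)`: the Killing form times the constant `κ`. -/
def ip (κ : ℝ) (x y : su2) : ℝ := κ * killingForm ℝ su2 x y

/-- `Φ(a₁, a₂, a₃) = ⟨a₁, [a₂, a₃]⟩`. -/
def Phi (κ : ℝ) (a : Su2Cubed) : ℝ := ip κ (a 0) ⁅a 1, a 2⁆

/-- The open subset `su(2)³_⋆ = {Φ ≠ 0}`. -/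
def starSet (κ : ℝ) : Set Su2Cubed := {a | Phi κ a ≠ 0}

/-- The open subset `su(2)³_+ = {Φ > 0}`. -/
def posSet (κ : ℝ) : Set Su2Cubed := {a | 0 < Phi κ a}

/-- The open subset `su(2)³_- = {Φ < 0}`. -/
def negSet (κ : ℝ) : Set Su2Cubed := {a | Phi κ a < 0}

/-! ### The three bivector fields

The form `⟨·, ·⟩` is nondegenerate for `κ ≠ 0`, so every covector at a point of `su(2)³` is
`∑ⱼ dlʲ_{ξ j}` for exactly one `ξ ∈ su(2)³`, where `lʲ_η (a) = ⟨η, aⱼ⟩`. A bivector field is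
therefore given by its values `π a ξ ζ` on the two covectors named by `ξ` and `ζ`. -/

/-- The covector `∑ⱼ dlʲ_{ξ j}` applied to the tangent vector `v`. -/
def covec (κ : ℝ) (ξ v : Su2Cubed) : ℝ := ∑ j, ip κ (ξ j) (v j)

/-- The symmetric tensor
`A = Φ⁻¹ ([a₁,a₂] ⊗ [a₁,a₂] + [a₂,a₃] ⊗ [a₂,a₃] + [a₃,a₁] ⊗ [a₃,a₁])` contracted with `x, y`. -/
def tensorA (κ : ℝ) (a : Su2Cubed) (x y : su2) : ℝ :=
  (Phi κ a)⁻¹ * (ip κ x ⁅a 0, a 1⁆ * ip κ y ⁅a 0, a 1⁆ + ip κ x ⁅a 1, a 2⁆ * ip κ y ⁅a 1, a 2⁆ +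
    ip κ x ⁅a 2, a 0⁆ * ip κ y ⁅a 2, a 0⁆)

/-- The bracket `{lⁱ_x, lʲ_y}` of the first structure at the point `a` (indices start at `0`). -/
def basicBracket (κ : ℝ) (a : Su2Cubed) (x y : su2) : Fin 3 → Fin 3 → ℝ :=
  ![![ip κ ⁅x, y⁆ (a 0), ip κ ⁅x, y⁆ (a 1), ip κ ⁅x, y⁆ (a 2)],
    ![ip κ ⁅x, y⁆ (a 1), -ip κ ⁅x, y⁆ (a 0), tensorA κ a x y],
    ![ip κ ⁅x, y⁆ (a 2), -tensorA κ a x y, -ip κ ⁅x, y⁆ (a 0)]]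

/-- The bivector field `π₁`. -/
def pi1 (κ : ℝ) (a ξ ζ : Su2Cubed) : ℝ := ∑ i, ∑ j, basicBracket κ a (ξ i) (ζ j) i j

/-- The inverse `(a₁, a₂, a₃) ↦ (a₂, a₃, a₁)` of the cyclic permutation
`σ (a₁, a₂, a₃) = (a₃, a₁, a₂)`. -/
def cycInv (a : Su2Cubed) : Su2Cubed := ![a 1, a 2, a 0]

/-- The pushforward `σ_* π`. As `σ` preserves the pairing `covec`, the pullback by `σ` of the
covector named by `ξ` is the covector named by `σ⁻¹ ξ`. -/
def pushCyc (π : Su2Cubed → Su2Cubed → Su2Cubed → ℝ) (a ξ ζ : Su2Cubed) : ℝ :=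
  π (cycInv a) (cycInv ξ) (cycInv ζ)

/-- The three bivector fields `π₁`, `π₂ = σ_* π₁`, `π₃ = σ_* π₂` (with indices `0, 1, 2`). -/
def poisson (κ : ℝ) : Fin 3 → Su2Cubed → Su2Cubed → Su2Cubed → ℝ :=
  ![pi1 κ, pushCyc (pi1 κ), pushCyc (pushCyc (pi1 κ))]

/-- `u = πᵢ^♯(ξ)` at the point `a`, that is, `β(u) = πᵢ(ξ, β)` for all covectors `β`. -/
def IsSharp (κ : ℝ) (i : Fin 3) (a ξ u : Su2Cubed) : Prop :=
  ∀ ζ : Su2Cubed, covec κ ζ u = poisson κ i a ξ ζ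

/-- The symplectic distribution `𝒟 = π₁^♯(T^*)` at the point `a`. -/
def symplecticDist (κ : ℝ) (a : Su2Cubed) : Set Su2Cubed := {u | ∃ ξ, IsSharp κ 0 a ξ u}

/-! ### Symplectic leaves -/

/-- `a` and `b` are the end points of a `C¹` path in `su(2)³_⋆` that is tangent to the symplectic
distribution. -/
def TangentPath (κ : ℝ) (a b : Su2Cubed) : Prop :=
  ∃ γ : ℝ → Su2Cubed, ContDiffOn ℝ 1 γ (Set.Icc 0 1) ∧ γ 0 = a ∧ γ 1 = b ∧
    ∀ t ∈ Set.Icc (0 : ℝ) 1,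
      γ t ∈ starSet κ ∧ derivWithin γ (Set.Icc 0 1) t ∈ symplecticDist κ (γ t)

/-- The symplectic leaf through `a`: all points that can be reached from `a` by a piecewise `C¹`
path in `su(2)³_⋆` tangent to the symplectic distribution. -/
def leafThrough (κ : ℝ) (a : Su2Cubed) : Set Su2Cubed :=
  {b | Relation.ReflTransGen (TangentPath κ) a b}

/-- `L` is a symplectic leaf of `su(2)³_⋆`. -/
def IsLeaf (κ : ℝ) (L : Set Su2Cubed) : Prop := ∃ a ∈ starSet κ, L = leafThrough κ a

/-- `L` is an embedded smooth submanifold of codimension `5` whose tangent space at each point is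
the symplectic distribution: near each of its points, `L` is a level set of a smooth submersion
to `ℝ⁵` whose derivative has kernel `𝒟`. -/
def IsIntegralSubmanifold (κ : ℝ) (L : Set Su2Cubed) : Prop :=
  ∀ p ∈ L, ∃ (U : Set Su2Cubed) (f : Su2Cubed → EuclideanSpace ℝ (Fin 5)),
    IsOpen U ∧ p ∈ U ∧ ContDiffOn ℝ ∞ f U ∧ L ∩ U = {x | x ∈ U ∧ f x = f p} ∧
    ∀ x ∈ L ∩ U, Function.Surjective (fderiv ℝ f x) ∧ {u | fderiv ℝ f x u = 0} = symplecticDist κ x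

/-! ### The structure of a leaf: three symplectic forms and a metric -/

open Classical in
/-- The symplectic form `ωᵢ` of the leaf through `a`, on the tangent space `𝒟` at `a`. It is
determined by `(ωᵢ^♭)⁻¹ = πᵢ^♯`, that is, `ωᵢ(πᵢ^♯ ξ, v) = ξ(v)`; by skew-symmetry of `πᵢ` the
value does not depend on the covector `ξ` with `πᵢ^♯ ξ = u`. -/
def omega (κ : ℝ) (i : Fin 3) (a u v : Su2Cubed) : ℝ :=
  if h : ∃ ξ, IsSharp κ i a ξ u then covec κ h.choose v else 0

open Classical in
/-- The metric `g^♭ = ω₃^♭ ∘ (ω₁^♭)⁻¹ ∘ ω₂^♭` of the leaf through `a`, on the tangent space `𝒟` at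
`a`: `g(u, v) = ω₃(w, v)` for the tangent vector `w` with `ω₁(w, ·) = ω₂(u, ·)`. -/
def metric (κ : ℝ) (a u v : Su2Cubed) : ℝ :=
  if h : ∃ w ∈ symplecticDist κ a, ∀ z ∈ symplecticDist κ a, omega κ 0 a w z = omega κ 1 a u z then
    omega κ 2 a h.choose v
  else 0

/-- The metric is positive-definite on `L`. -/
def MetricPosDef (κ : ℝ) (L : Set Su2Cubed) : Prop :=
  ∀ a ∈ L, ∀ u ∈ symplecticDist κ a, u ≠ 0 → 0 < metric κ a u u

/-- The metric is negative-definite on `L`. -/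
def MetricNegDef (κ : ℝ) (L : Set Su2Cubed) : Prop :=
  ∀ a ∈ L, ∀ u ∈ symplecticDist κ a, u ≠ 0 → metric κ a u u < 0

/-! ### Isomorphisms of leaves -/

/-- `G` is a smooth extension of `F : S → su(2)³` to a neighbourhood of `p`. -/
def IsLocalExtension (S : Set Su2Cubed) (F : S → Su2Cubed) (p : S) (G : Su2Cubed → Su2Cubed) :
    Prop :=
  ContDiffAt ℝ ∞ G p ∧ ∀ᶠ x in 𝓝 (p : Su2Cubed), ∀ hx : x ∈ S, G x = F ⟨x, hx⟩

/-- A map on a submanifold `S` is smooth if it extends smoothly to a neighbourhood of each point. -/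
def SmoothMap (S : Set Su2Cubed) (F : S → Su2Cubed) : Prop :=
  ∀ p : S, ∃ G, IsLocalExtension S F p G

/-- The bijection `F : L → N` is a diffeomorphism of leaves with
`F^*(ω₁, ω₂, ω₃) = (ω₁, ω₂, ω₃) O`. The tangent map of `F` at `p` is the restriction to `𝒟` of the
derivative of any local smooth extension of `F`. -/
structure IsIsomorphismVia (κ : ℝ) (L N : Set Su2Cubed) (F : L ≃ N)
    (O : Matrix (Fin 3) (Fin 3) ℝ) : Prop where
  smooth : SmoothMap L (fun x => (F x : Su2Cubed))
  smooth_symm : SmoothMap N (fun y => (F.symm y : Su2Cubed))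
  tangent : ∀ (p : L) (G : Su2Cubed → Su2Cubed),
    IsLocalExtension L (fun x => (F x : Su2Cubed)) p G →
      ∀ u ∈ symplecticDist κ p, fderiv ℝ G p u ∈ symplecticDist κ (F p)
  pullback : ∀ (p : L) (G : Su2Cubed → Su2Cubed),
    IsLocalExtension L (fun x => (F x : Su2Cubed)) p G →
      ∀ u ∈ symplecticDist κ p, ∀ v ∈ symplecticDist κ p, ∀ j : Fin 3,
        omega κ j (F p) (fderiv ℝ G p u) (fderiv ℝ G p v) = ∑ i, omega κ i p u v * O i j

/-- `L` and `N` are isomorphic: `F^*(ω₁, ω₂, ω₃) = (ω₁, ω₂, ω₃) O` with `O ∈ SO(3)`. -/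
def Isomorphic (κ : ℝ) (L N : Set Su2Cubed) : Prop :=
  ∃ (F : L ≃ N) (O : Matrix (Fin 3) (Fin 3) ℝ),
    O ∈ Matrix.orthogonalGroup (Fin 3) ℝ ∧ O.det = 1 ∧ IsIsomorphismVia κ L N F O

/-- `L` and `N` are anti-isomorphic: `F^*(ω₁, ω₂, ω₃) = (ω₁, ω₂, ω₃) O` with `O ∈ O(3)`,
`det O = -1`. -/
def AntiIsomorphic (κ : ℝ) (L N : Set Su2Cubed) : Prop :=
  ∃ (F : L ≃ N) (O : Matrix (Fin 3) (Fin 3) ℝ),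
    O ∈ Matrix.orthogonalGroup (Fin 3) ℝ ∧ O.det = -1 ∧ IsIsomorphismVia κ L N F O

/-- The normal form `N_{q,r}`. -/
def normalForm (κ q r : ℝ) : Set Su2Cubed :=
  {a | a ∈ starSet κ ∧ ip κ (a 0) ⁅a 1, a 2⁆ < 0 ∧ (∀ i j, i ≠ j → ip κ (a i) (a j) = 0) ∧
    ip κ (a 0) (a 0) - ip κ (a 1) (a 1) = q ∧ ip κ (a 1) (a 1) - ip κ (a 2) (a 2) = r}

end HyperLie

end

noncomputable section

namespace HyperLie

attribute [local instance] LieRing.ofAssociativeRing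

/-! ### Coordinates on `su(2)` -/

/-! In coordinates where the bracket is the cross product and the Killing form is −2 times the dot
product, a triple is a 3 × 3 matrix a (`mat`) and Φ = −2κ det a. At an invertible a, write covectors
as Y·a and encode a tangent vector u by W = u·aᵀ. In this frame π₁ has constant coefficients up to
the factor det a (`pi1_eq`), and the image of π₁^♯ consists of the matrices W = x·1 + [y]×
(`mem_symplecticDist`), to be read as quaternions x + y. The cyclic symmetry permutes the entries of
y, so each ωᵢ is 2κ/det a times a standard quaternionic form (`omega_eq`), and the metric is 2κ/det
a times the squared quaternion norm (`metric_self_eq`). Its sign is opposite to that of Φ.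

W has this shape iff W + Wᵀ, the derivative of the Gram matrix aaᵀ, is scalar. Hence 𝒟 is the kernel
of the derivative of aaᵀ modulo scalars: five Casimir functions, submersive at invertible a. A leaf
is a level of these on one side of Φ = 0 (`leafThrough_eq_level`): inside a level, one path shifts
aaᵀ by a scalar, and right rotations, split by Euler angles, join triples with equal Gram matrices.

O(3) acts from the left by a ↦ Oᵀa. It sends aaᵀ to Oᵀ(aaᵀ)O, hence levels to levels, and y to
adj(O)y = det O · Oᵀy. The factor det O cancels against the one in det a, leaving F^*ω = ωO for
every orthogonal O (`exists_isIsomorphismVia`). Diagonalising −2κ aaᵀ with decreasing eigenvalues,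
with det O = ±1 chosen by the side of Φ = 0, brings the level to some N_{q,r}
(`exists_mix_mem_normalForm`). -/

/-- Coordinates on `su(2)` in which the bracket is the cross product. -/
def coord : su2 ≃ₗ[ℝ] (Fin 3 → ℝ) where
  toFun x := ![2 * (x.1 0 0).im, 2 * (x.1 0 1).re, 2 * (x.1 0 1).im]
  map_add' x y := by
    ext i; fin_cases i <;> simp [mul_add]
  map_smul' r x := by
    ext i; fin_cases i <;> simp [mul_left_comm]
  invFun v := ⟨!![⟨0, v 0 / 2⟩, ⟨v 1 / 2, v 2 / 2⟩; ⟨-(v 1 / 2), v 2 / 2⟩, ⟨0, -(v 0 / 2)⟩], by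
    refine ⟨?_, ?_⟩
    · ext i j; fin_cases i <;> fin_cases j <;> simp [Complex.ext_iff]
    · simp [Matrix.trace_fin_two, Complex.ext_iff]⟩
  left_inv x := by
    obtain ⟨x, hx, ht⟩ := x
    have h00 := congrFun (congrFun hx 0) 0
    have h10 := congrFun (congrFun hx 1) 0
    rw [Matrix.trace_fin_two] at ht
    simp only [Matrix.conjTranspose_apply, Matrix.neg_apply, Complex.ext_iff, Complex.star_def,
      Complex.conj_re, Complex.conj_im, Complex.neg_re, Complex.neg_im, Complex.add_re,
      Complex.add_im, Complex.zero_re, Complex.zero_im] at h00 h10 ht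
    apply Subtype.ext
    ext i j
    fin_cases i <;> fin_cases j <;> simp [Complex.ext_iff] <;> (try constructor) <;> linarith
  right_inv v := by
    ext i; fin_cases i <;> simp <;> ring

lemma coord_apply (x : su2) :
    coord x = ![2 * (x.1 0 0).im, 2 * (x.1 0 1).re, 2 * (x.1 0 1).im] := rfl

lemma coord_lie (x y : su2) :
    coord ⁅x, y⁆ = ![coord x 1 * coord y 2 - coord x 2 * coord y 1,
      coord x 2 * coord y 0 - coord x 0 * coord y 2,
      coord x 0 * coord y 1 - coord x 1 * coord y 0] := by
  obtain ⟨v, rfl⟩ := coord.symm.surjective x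
  obtain ⟨w, rfl⟩ := coord.symm.surjective y
  rw [LinearEquiv.apply_symm_apply, LinearEquiv.apply_symm_apply, coord_apply,
    LieSubalgebra.coe_bracket, Ring.lie_def]
  ext i
  fin_cases i <;> simp [coord] <;> ring

/-- Since ad x is the cross product with x, the map z ↦ x × (y × z) = (x·z) y − (x·y) z has trace −2
x·y. -/
lemma killingForm_eq (x y : su2) :
    killingForm ℝ su2 x y =
      -2 * (coord x 0 * coord y 0 + coord x 1 * coord y 1 + coord x 2 * coord y 2) := by
  rw [killingForm_apply_apply, LinearMap.trace_eq_matrix_trace ℝ (Module.Basis.ofEquivFun coord),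
    Matrix.trace_fin_three]
  simp only [LinearMap.toMatrix_apply, Module.Basis.ofEquivFun_repr_apply, LinearMap.comp_apply,
    LieAlgebra.ad_apply, coord_lie, Module.Basis.coe_ofEquivFun, LinearEquiv.apply_symm_apply]
  simp
  ring

lemma ip_eq (κ : ℝ) (x y : su2) :
    ip κ x y =
      -2 * κ * (coord x 0 * coord y 0 + coord x 1 * coord y 1 + coord x 2 * coord y 2) := by
  rw [ip, killingForm_eq]; ring

/-- The `3 × 3` matrix whose rows are the coordinates of the entries of a triple. -/
def mat : Su2Cubed ≃ₗ[ℝ] Matrix (Fin 3) (Fin 3) ℝ where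
  toFun a := Matrix.of fun i => coord (a i)
  map_add' a b := by ext i j; simp
  map_smul' r a := by ext i j; simp
  invFun A := fun i => coord.symm (A i)
  left_inv a := funext fun i => coord.symm_apply_apply (a i)
  right_inv A := Matrix.ext fun i j => congrFun (coord.apply_symm_apply (A i)) j

lemma mat_apply (a : Su2Cubed) (i j : Fin 3) : mat a i j = coord (a i) j := rfl

instance : IsTopologicalAddGroup su2 :=
  @SeminormedAddCommGroup.toIsTopologicalAddGroup su2 NormedAddCommGroup.toSeminormedAddCommGroup

instance : ContinuousSMul ℝ su2 :=
  @IsBoundedSMul.continuousSMul ℝ su2 _ _ _ _ _ NormedSpace.toIsBoundedSMul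

instance : FiniteDimensional ℝ su2 := Module.Finite.equiv coord.symm

/-- An entry of the coordinate matrix, as a continuous linear form. -/
def entry (i j : Fin 3) : Su2Cubed →L[ℝ] ℝ where
  toFun a := mat a i j
  map_add' a b := by simp
  map_smul' r a := by simp
  cont := LinearMap.continuous_of_finiteDimensional ((LinearMap.proj j : (Fin 3 → ℝ) →ₗ[ℝ] ℝ) ∘ₗ
    (LinearMap.proj i : (Fin 3 → Fin 3 → ℝ) →ₗ[ℝ] Fin 3 → ℝ) ∘ₗ mat.toLinearMap)

@[simp] lemma entry_apply (i j : Fin 3) (a : Su2Cubed) : entry i j a = mat a i j := rfl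

lemma Phi_eq (κ : ℝ) (a : Su2Cubed) : Phi κ a = -2 * κ * (mat a).det := by
  rw [Phi, ip_eq, coord_lie, Matrix.det_fin_three]
  simp only [mat_apply, Matrix.cons_val]
  ring

lemma mem_starSet {κ : ℝ} (hκ : κ ≠ 0) {a : Su2Cubed} : a ∈ starSet κ ↔ (mat a).det ≠ 0 := by
  simp [starSet, Phi_eq, hκ]

lemma ip_apply (κ : ℝ) (a : Su2Cubed) (i j : Fin 3) :
    ip κ (a i) (a j) = -2 * κ * (mat a * (mat a).transpose) i j := by
  rw [ip_eq, Matrix.mul_apply, Fin.sum_univ_three]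
  rfl

lemma covec_eq (κ : ℝ) (ξ v : Su2Cubed) :
    covec κ ξ v = -2 * κ * (mat ξ * (mat v).transpose).trace := by
  simp only [covec, ip_eq, Matrix.trace_fin_three, Matrix.mul_apply, Fin.sum_univ_three,
    Matrix.transpose_apply, mat_apply]
  ring

/-! ### The symplectic distribution and the symplectic forms in a moving frame -/

/-- The matrix of left multiplication by a quaternion, modulo the identification of `𝒟` with `ℍ`:
the scalar matrix `x` plus the cross product with `y`. -/
def quat (x : ℝ) (y : Fin 3 → ℝ) : Matrix (Fin 3) (Fin 3) ℝ :=
  !![x, -y 2, y 1; y 2, x, -y 0; -y 1, y 0, x]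

lemma quat_inj {x x' : ℝ} {y y' : Fin 3 → ℝ} (h : quat x y = quat x' y') : x = x' ∧ y = y' := by
  have h00 := congrFun (congrFun h 0) 0
  have h21 := congrFun (congrFun h 2) 1
  have h02 := congrFun (congrFun h 0) 2
  have h10 := congrFun (congrFun h 1) 0
  simp [quat] at h00 h21 h02 h10
  refine ⟨h00, ?_⟩
  ext i; fin_cases i <;> assumption

/-- `x` has coordinates `y` in the frame `a`. -/
def InFrame (a : Su2Cubed) (x : su2) (y : Fin 3 → ℝ) : Prop :=
  ∀ k, coord x k = y 0 * mat a 0 k + y 1 * mat a 1 k + y 2 * mat a 2 k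

/-- The triple product of frame vectors is det a times the Levi-Civita symbol, so the cross product
of the frame coordinates appears. -/
lemma ip_lie_of_inFrame {κ : ℝ} {a : Su2Cubed} {x z : su2} {y w : Fin 3 → ℝ}
    (hx : InFrame a x y) (hz : InFrame a z w) (k : Fin 3) :
    ip κ ⁅x, z⁆ (a k) = -2 * κ * (mat a).det *
      (![y 1 * w 2 - y 2 * w 1, y 2 * w 0 - y 0 * w 2, y 0 * w 1 - y 1 * w 0] : Fin 3 → ℝ) k := by
  rw [ip_eq, coord_lie, Matrix.det_fin_three]
  simp only [hx 0, hx 1, hx 2, hz 0, hz 1, hz 2, ← mat_apply]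
  fin_cases k <;> simp <;> ring

/-- The brackets of the frame vectors are det a times the dual frame, so pairing with them reads off
frame coordinates. Of the two factors det a, one is cancelled by Φ⁻¹. -/
lemma tensorA_of_inFrame {κ : ℝ} (hκ : κ ≠ 0) {a : Su2Cubed} (ha : (mat a).det ≠ 0) {x z : su2}
    {y w : Fin 3 → ℝ} (hx : InFrame a x y) (hz : InFrame a z w) :
    tensorA κ a x z = -2 * κ * (mat a).det * (y 0 * w 0 + y 1 * w 1 + y 2 * w 2) := by
  have key : ∀ {x : su2} {y : Fin 3 → ℝ}, InFrame a x y →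
      ip κ x ⁅a 0, a 1⁆ = -2 * κ * (mat a).det * y 2 ∧
      ip κ x ⁅a 1, a 2⁆ = -2 * κ * (mat a).det * y 0 ∧
      ip κ x ⁅a 2, a 0⁆ = -2 * κ * (mat a).det * y 1 := by
    intro x y hx
    refine ⟨?_, ?_, ?_⟩ <;>
    · rw [ip_eq, coord_lie, Matrix.det_fin_three]
      simp only [hx 0, hx 1, hx 2, ← mat_apply, Matrix.cons_val]
      ring
  obtain ⟨h1, h2, h3⟩ := key hx
  obtain ⟨h4, h5, h6⟩ := key hz
  rw [tensorA, h1, h2, h3, h4, h5, h6, Phi_eq]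
  field_simp
  ring

lemma inFrame_of_mat_eq {a ξ : Su2Cubed} {Y : Matrix (Fin 3) (Fin 3) ℝ} (h : mat ξ = Y * mat a)
    (i : Fin 3) : InFrame a (ξ i) (Y i) := fun k => by
  rw [← mat_apply, h, Matrix.mul_apply, Fin.sum_univ_three]

/-- The value of `π₁^♯` on the covector with matrix `Y` in the frame `a`. -/
def sharpQuat (Y : Matrix (Fin 3) (Fin 3) ℝ) : Matrix (Fin 3) (Fin 3) ℝ :=
  quat (Y 1 2 - Y 2 1) ![Y 0 0 + Y 1 1 + Y 2 2, Y 0 1 - Y 1 0, Y 0 2 - Y 2 0]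

lemma pi1_eq {κ : ℝ} (hκ : κ ≠ 0) {a ξ ζ : Su2Cubed} (ha : (mat a).det ≠ 0)
    {Y Z : Matrix (Fin 3) (Fin 3) ℝ} (hξ : mat ξ = Y * mat a) (hζ : mat ζ = Z * mat a) :
    pi1 κ a ξ ζ = -2 * κ * (mat a).det * (Z * (sharpQuat Y).transpose).trace := by
  have hl := fun i j => ip_lie_of_inFrame (κ := κ) (inFrame_of_mat_eq hξ i) (inFrame_of_mat_eq hζ j)
  have hA := fun i j => tensorA_of_inFrame hκ ha (inFrame_of_mat_eq hξ i) (inFrame_of_mat_eq hζ j)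
  simp only [pi1, basicBracket, Fin.sum_univ_three, Matrix.cons_val, hl, hA, Matrix.trace_fin_three,
    Matrix.mul_apply, Matrix.transpose_apply, sharpQuat, quat, Matrix.of_apply]
  ring

lemma exists_mat_eq_mul {a : Su2Cubed} (ha : (mat a).det ≠ 0) (ξ : Su2Cubed) :
    ∃ Y, mat ξ = Y * mat a :=
  ⟨mat ξ * (mat a)⁻¹, by rw [Matrix.nonsing_inv_mul_cancel_right _ _ ha.isUnit]⟩

lemma exists_mat_mul_transpose_eq {a : Su2Cubed} (ha : (mat a).det ≠ 0)
    (W : Matrix (Fin 3) (Fin 3) ℝ) : ∃ u, mat u * (mat a).transpose = W :=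
  ⟨mat.symm (W * ((mat a).transpose)⁻¹), by
    rw [LinearEquiv.apply_symm_apply,
      Matrix.nonsing_inv_mul_cancel_right _ _ (by rwa [Matrix.det_transpose, isUnit_iff_ne_zero])]⟩

lemma covec_of_mat_eq (κ : ℝ) {a ξ v : Su2Cubed} {Y : Matrix (Fin 3) (Fin 3) ℝ}
    (hξ : mat ξ = Y * mat a) :
    covec κ ξ v = -2 * κ * (Y * (mat v * (mat a).transpose).transpose).trace := by
  rw [covec_eq, hξ, Matrix.transpose_mul, Matrix.transpose_transpose, Matrix.mul_assoc]

/-- Both sides of the condition are −2κ times a trace pairing with an arbitrary Z, and the trace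
pairing is nondegenerate. -/
lemma isSharp_zero_iff {κ : ℝ} (hκ : κ ≠ 0) {a ξ u : Su2Cubed} (ha : (mat a).det ≠ 0)
    {Y : Matrix (Fin 3) (Fin 3) ℝ} (hξ : mat ξ = Y * mat a) :
    IsSharp κ 0 a ξ u ↔ mat u * (mat a).transpose = (mat a).det • sharpQuat Y := by
  have hz : ∀ ζ Z, mat ζ = Z * mat a → (covec κ ζ u = poisson κ 0 a ξ ζ ↔
      (Z * (mat u * (mat a).transpose).transpose).trace =
        (Z * ((mat a).det • sharpQuat Y).transpose).trace) := by
    intro ζ Z hζ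
    have h0 : poisson κ 0 a ξ ζ = pi1 κ a ξ ζ := rfl
    rw [h0, covec_of_mat_eq κ hζ, pi1_eq hκ ha hξ hζ, Matrix.transpose_smul, Matrix.mul_smul,
      Matrix.trace_smul, smul_eq_mul, mul_assoc (-2 * κ)]
    exact mul_right_inj' (by simpa using hκ)
  constructor
  · intro h
    apply Matrix.transpose_injective
    refine Matrix.ext_iff_trace_mul_left.2 fun Z => ?_
    have hZ : mat (mat.symm (Z * mat a)) = Z * mat a := LinearEquiv.apply_symm_apply _ _
    exact (hz _ Z hZ).1 (h _)
  · intro h ζ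
    obtain ⟨Z, hζ⟩ := exists_mat_eq_mul ha ζ
    rw [hz ζ Z hζ, h]

lemma mem_symplecticDist {κ : ℝ} (hκ : κ ≠ 0) {a u : Su2Cubed} (ha : (mat a).det ≠ 0) :
    u ∈ symplecticDist κ a ↔ ∃ x y, mat u * (mat a).transpose = quat x y := by
  constructor
  · rintro ⟨ξ, h⟩
    obtain ⟨Y, hY⟩ := exists_mat_eq_mul ha ξ
    rw [isSharp_zero_iff hκ ha hY] at h
    refine ⟨_, _, h.trans (?_ : _ = quat ((mat a).det * (Y 1 2 - Y 2 1))
      ((mat a).det • ![Y 0 0 + Y 1 1 + Y 2 2, Y 0 1 - Y 1 0, Y 0 2 - Y 2 0]))⟩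
    ext i j; fin_cases i <;> fin_cases j <;> simp [sharpQuat, quat] <;> ring
  · rintro ⟨x, y, h⟩
    -- One of many preimages: each argument of `quat` in `sharpQuat` is hit by a single entry.
    let Y : Matrix (Fin 3) (Fin 3) ℝ := (mat a).det⁻¹ • !![y 0, y 1, y 2; 0, 0, x; 0, 0, 0]
    refine ⟨mat.symm (Y * mat a), ?_⟩
    rw [isSharp_zero_iff hκ ha (LinearEquiv.apply_symm_apply _ _), h]
    ext i j; fin_cases i <;> fin_cases j <;> simp [sharpQuat, quat, Y] <;> field_simp

/-- The value of `ωᵢ` in the frame. -/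
def omegaQuat (i : Fin 3) (x : ℝ) (y : Fin 3 → ℝ) (x' : ℝ) (y' : Fin 3 → ℝ) : ℝ :=
  x * y' i - x' * y i + (y (i + 1) * y' (i + 2) - y (i + 2) * y' (i + 1))

/-- The answer involves only the encodings of u and v, so the choice of covector in `omega` is
immaterial. -/
lemma covec_of_isSharp_zero {κ : ℝ} (hκ : κ ≠ 0) {a ξ u v : Su2Cubed} (ha : (mat a).det ≠ 0)
    {x x' : ℝ} {y y' : Fin 3 → ℝ} (h : IsSharp κ 0 a ξ u)
    (hu : mat u * (mat a).transpose = quat x y) (hv : mat v * (mat a).transpose = quat x' y') :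
    covec κ ξ v = 2 * κ * (mat a).det⁻¹ * omegaQuat 0 x y x' y' := by
  obtain ⟨Y, hY⟩ := exists_mat_eq_mul ha ξ
  rw [isSharp_zero_iff hκ ha hY, hu] at h
  have h' : quat x y = quat ((mat a).det * (Y 1 2 - Y 2 1))
      ((mat a).det • ![Y 0 0 + Y 1 1 + Y 2 2, Y 0 1 - Y 1 0, Y 0 2 - Y 2 0]) := by
    rw [h]
    ext i j; fin_cases i <;> fin_cases j <;> simp [sharpQuat, quat] <;> ring
  obtain ⟨rfl, rfl⟩ := quat_inj h'
  rw [covec_of_mat_eq κ hY, hv]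
  simp only [Matrix.trace_fin_three, Matrix.mul_apply, Fin.sum_univ_three, Matrix.transpose_apply,
    quat, omegaQuat, Matrix.of_apply, Matrix.cons_val, Pi.smul_apply, smul_eq_mul, zero_add]
  field_simp
  ring

/-! ### Cyclic symmetry -/

lemma covec_cycInv (κ : ℝ) (ξ v : Su2Cubed) : covec κ (cycInv ξ) (cycInv v) = covec κ ξ v := by
  simp only [covec, cycInv, Fin.sum_univ_three, Matrix.cons_val]
  ring

lemma cycInv_surjective : Function.Surjective cycInv := fun a => by
  refine ⟨![a 2, a 0, a 1], ?_⟩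
  ext1 i; fin_cases i <;> rfl

lemma det_mat_cycInv (a : Su2Cubed) : (mat (cycInv a)).det = (mat a).det := by
  simp only [Matrix.det_fin_three, mat_apply, cycInv, Matrix.cons_val]
  ring

/-- Relabelling the rows conjugates W by a cyclic permutation matrix, which fixes the scalar part
and cycles the vector part. -/
lemma mat_cycInv_mul {a u : Su2Cubed} {x : ℝ} {y : Fin 3 → ℝ}
    (h : mat u * (mat a).transpose = quat x y) :
    mat (cycInv u) * (mat (cycInv a)).transpose = quat x ![y 1, y 2, y 0] := by
  have h' : ∀ i j, (mat (cycInv u) * (mat (cycInv a)).transpose) i j =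
      (mat u * (mat a).transpose) (i + 1) (j + 1) := by
    intro i j
    fin_cases i <;> fin_cases j <;> simp [Matrix.mul_apply, mat_apply, cycInv]
  ext i j
  rw [h', h]
  fin_cases i <;> fin_cases j <;> simp [quat]

lemma poisson_one (κ : ℝ) (a ξ ζ : Su2Cubed) :
    poisson κ 1 a ξ ζ = poisson κ 0 (cycInv a) (cycInv ξ) (cycInv ζ) := by
  simp only [poisson, Matrix.cons_val, pushCyc]

lemma isSharp_one_iff {κ : ℝ} {a ξ u : Su2Cubed} :
    IsSharp κ 1 a ξ u ↔ IsSharp κ 0 (cycInv a) (cycInv ξ) (cycInv u) := by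
  constructor
  · intro h ζ
    obtain ⟨ζ, rfl⟩ := cycInv_surjective ζ
    rw [covec_cycInv, h, poisson_one]
  · intro h ζ
    rw [← covec_cycInv, h, poisson_one]

lemma poisson_two (κ : ℝ) (a ξ ζ : Su2Cubed) :
    poisson κ 2 a ξ ζ = poisson κ 1 (cycInv a) (cycInv ξ) (cycInv ζ) := by
  simp only [poisson, Matrix.cons_val, pushCyc]

lemma isSharp_two_iff {κ : ℝ} {a ξ u : Su2Cubed} :
    IsSharp κ 2 a ξ u ↔ IsSharp κ 1 (cycInv a) (cycInv ξ) (cycInv u) := by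
  constructor
  · intro h ζ
    obtain ⟨ζ, rfl⟩ := cycInv_surjective ζ
    rw [covec_cycInv, h, poisson_two]
  · intro h ζ
    rw [← covec_cycInv, h, poisson_two]

/-- One or two applications of `cycInv` reduce to π₁, and cycling y turns `omegaQuat 0` into
`omegaQuat 1` and `omegaQuat 2`. -/
lemma covec_of_isSharp {κ : ℝ} (hκ : κ ≠ 0) {i : Fin 3} {a ξ u v : Su2Cubed}
    (ha : (mat a).det ≠ 0) {x x' : ℝ} {y y' : Fin 3 → ℝ} (h : IsSharp κ i a ξ u)
    (hu : mat u * (mat a).transpose = quat x y) (hv : mat v * (mat a).transpose = quat x' y') :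
    covec κ ξ v = 2 * κ * (mat a).det⁻¹ * omegaQuat i x y x' y' := by
  have ha' := det_mat_cycInv a
  have ha'' := det_mat_cycInv (cycInv a)
  fin_cases i
  · exact covec_of_isSharp_zero hκ ha h hu hv
  · rw [← covec_cycInv, covec_of_isSharp_zero hκ (ha' ▸ ha) (isSharp_one_iff.1 h)
      (mat_cycInv_mul hu) (mat_cycInv_mul hv), ha']
    rfl
  · rw [← covec_cycInv, ← covec_cycInv, covec_of_isSharp_zero hκ (ha''.trans ha' ▸ ha)
      (isSharp_one_iff.1 (isSharp_two_iff.1 h)) (mat_cycInv_mul (mat_cycInv_mul hu))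
      (mat_cycInv_mul (mat_cycInv_mul hv)), ha'', ha']
    rfl

lemma exists_isSharp_zero {κ : ℝ} (hκ : κ ≠ 0) {a u : Su2Cubed} (ha : (mat a).det ≠ 0)
    {x : ℝ} {y : Fin 3 → ℝ} (hu : mat u * (mat a).transpose = quat x y) :
    ∃ ξ, IsSharp κ 0 a ξ u := (mem_symplecticDist hκ ha).2 ⟨x, y, hu⟩

lemma exists_isSharp {κ : ℝ} (hκ : κ ≠ 0) (i : Fin 3) {a u : Su2Cubed} (ha : (mat a).det ≠ 0)
    {x : ℝ} {y : Fin 3 → ℝ} (hu : mat u * (mat a).transpose = quat x y) :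
    ∃ ξ, IsSharp κ i a ξ u := by
  have ha' := det_mat_cycInv a
  have ha'' := det_mat_cycInv (cycInv a)
  fin_cases i
  · exact exists_isSharp_zero hκ ha hu
  · obtain ⟨ξ, h⟩ := exists_isSharp_zero hκ (ha' ▸ ha) (mat_cycInv_mul hu)
    obtain ⟨ξ, rfl⟩ := cycInv_surjective ξ
    exact ⟨ξ, isSharp_one_iff.2 h⟩
  · obtain ⟨ξ, h⟩ := exists_isSharp_zero hκ (ha''.trans ha' ▸ ha)
      (mat_cycInv_mul (mat_cycInv_mul hu))
    obtain ⟨ξ, rfl⟩ := cycInv_surjective ξ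
    obtain ⟨ξ, rfl⟩ := cycInv_surjective ξ
    exact ⟨ξ, isSharp_two_iff.2 (isSharp_one_iff.2 h)⟩

lemma omega_eq {κ : ℝ} (hκ : κ ≠ 0) (i : Fin 3) {a u v : Su2Cubed} (ha : (mat a).det ≠ 0)
    {x x' : ℝ} {y y' : Fin 3 → ℝ}
    (hu : mat u * (mat a).transpose = quat x y) (hv : mat v * (mat a).transpose = quat x' y') :
    omega κ i a u v = 2 * κ * (mat a).det⁻¹ * omegaQuat i x y x' y' := by
  have h := exists_isSharp hκ i ha hu
  rw [omega, dif_pos h]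
  exact covec_of_isSharp hκ ha h.choose_spec hu hv

lemma metric_self_eq {κ : ℝ} (hκ : κ ≠ 0) {a u : Su2Cubed} (ha : (mat a).det ≠ 0)
    {x : ℝ} {y : Fin 3 → ℝ} (hu : mat u * (mat a).transpose = quat x y) :
    metric κ a u u =
      2 * κ * (mat a).det⁻¹ * (x ^ 2 + y 0 ^ 2 + y 1 ^ 2 + y 2 ^ 2) := by
  have hc : 2 * κ * (mat a).det⁻¹ ≠ 0 := by simp [hκ, ha]
  have hex : ∃ w ∈ symplecticDist κ a, ∀ z ∈ symplecticDist κ a,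
      omega κ 0 a w z = omega κ 1 a u z := by
    -- For u = x + y₀i + y₁j + y₂k this is the quaternion −k·u.
    obtain ⟨w, hw⟩ := exists_mat_mul_transpose_eq ha (quat (y 2) ![y 1, -y 0, -x])
    refine ⟨w, (mem_symplecticDist hκ ha).2 ⟨_, _, hw⟩, fun z hz => ?_⟩
    obtain ⟨x', y', hz⟩ := (mem_symplecticDist hκ ha).1 hz
    rw [omega_eq hκ 0 ha hw hz, omega_eq hκ 1 ha hu hz]
    simp [omegaQuat]
    ring_nf
    simp
  rw [metric, dif_pos hex]
  obtain ⟨hw, hwz⟩ := hex.choose_spec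
  obtain ⟨x', y', hw⟩ := (mem_symplecticDist hκ ha).1 hw
  -- The chosen w is known only through its pairings. Testing on the basis 1, i, j, k recovers its
  -- four coordinates.
  have test : ∀ (t : ℝ) (q : Fin 3 → ℝ), omegaQuat 0 x' y' t q = omegaQuat 1 x y t q := by
    intro t q
    obtain ⟨z, hz⟩ := exists_mat_mul_transpose_eq ha (quat t q)
    have := hwz z ((mem_symplecticDist hκ ha).2 ⟨_, _, hz⟩)
    rw [omega_eq hκ 0 ha hw hz, omega_eq hκ 1 ha hu hz] at this
    exact mul_left_cancel₀ hc this
  rw [omega_eq hκ 2 ha hw hu]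
  have t0 := test 1 0
  have t1 := test 0 ![1, 0, 0]
  have t2 := test 0 ![0, 1, 0]
  have t3 := test 0 ![0, 0, 1]
  simp [omegaQuat] at t0 t1 t2 t3 ⊢
  grind

/-! ### The Casimir functions -/

/-- The five functions which cut out the leaves: the Gram matrix of `a` modulo scalar matrices,
computed from a symmetric matrix of functions. -/
def traceFree {M : Type*} [AddGroup M] (g : Fin 3 → Fin 3 → M) : Fin 5 → M :=
  ![g 0 1, g 0 2, g 1 2, g 0 0 - g 1 1, g 1 1 - g 2 2]

/-- The Casimir functions, as a map to `ℝ⁵`. -/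
def casimir (a : Su2Cubed) : EuclideanSpace ℝ (Fin 5) :=
  (EuclideanSpace.equiv (Fin 5) ℝ).symm (traceFree (mat a * (mat a).transpose))

/-- The derivative of an entry of the Gram matrix. -/
def gramDeriv (a : Su2Cubed) (i j : Fin 3) : Su2Cubed →L[ℝ] ℝ :=
  ∑ k, (mat a i k • entry j k + mat a j k • entry i k)

/-- The derivative of the Casimir functions. -/
def casimirDeriv (a : Su2Cubed) : Su2Cubed →L[ℝ] EuclideanSpace ℝ (Fin 5) :=
  ((EuclideanSpace.equiv (Fin 5) ℝ).symm : (Fin 5 → ℝ) →L[ℝ] EuclideanSpace ℝ (Fin 5)) ∘L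
    ContinuousLinearMap.pi (traceFree (gramDeriv a))

lemma gramDeriv_apply (a u : Su2Cubed) (i j : Fin 3) :
    gramDeriv a i j u =
      (mat u * (mat a).transpose) i j + (mat u * (mat a).transpose) j i := by
  simp [gramDeriv, Matrix.mul_apply, Fin.sum_univ_three]
  ring

/-- A symmetric matrix is determined modulo scalars by its upper off-diagonal entries and the
differences of its diagonal entries. -/
lemma casimir_eq_iff {a b : Su2Cubed} : casimir b = casimir a ↔
    ∃ s : ℝ, mat b * (mat b).transpose = mat a * (mat a).transpose + s • 1 := by
  have hsym : ∀ (c : Su2Cubed) (i j : Fin 3),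
      (mat c * (mat c).transpose) i j = (mat c * (mat c).transpose) j i := by
    intro c i j
    simp [Matrix.mul_apply, mul_comm]
  rw [casimir, casimir, (EuclideanSpace.equiv (Fin 5) ℝ).symm.injective.eq_iff]
  constructor
  · intro h
    have h0 := congrFun h 0
    have h1 := congrFun h 1
    have h2 := congrFun h 2
    have h3 := congrFun h 3
    have h4 := congrFun h 4
    simp only [traceFree, Matrix.cons_val] at h0 h1 h2 h3 h4
    refine ⟨(mat b * (mat b).transpose) 0 0 - (mat a * (mat a).transpose) 0 0, ?_⟩
    have s0 := hsym a 0 1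
    have s1 := hsym a 0 2
    have s2 := hsym a 1 2
    have t0 := hsym b 0 1
    have t1 := hsym b 0 2
    have t2 := hsym b 1 2
    ext i j
    rw [Matrix.add_apply, Matrix.smul_apply, smul_eq_mul]
    fin_cases i <;> fin_cases j <;> simp <;> linarith
  · rintro ⟨s, h⟩
    ext i
    fin_cases i <;> simp [traceFree, h]

lemma hasStrictFDerivAt_casimir (a : Su2Cubed) : HasStrictFDerivAt casimir (casimirDeriv a) a := by
  have hg : ∀ i j, HasStrictFDerivAt (fun b => (mat b * (mat b).transpose) i j)
      (gramDeriv a i j) a := by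
    intro i j
    simp only [Matrix.mul_apply, Matrix.transpose_apply]
    exact HasStrictFDerivAt.fun_sum fun k _ =>
      (entry i k).hasStrictFDerivAt.mul (entry j k).hasStrictFDerivAt
  have h : HasStrictFDerivAt (fun b => traceFree (mat b * (mat b).transpose))
      (ContinuousLinearMap.pi (traceFree (gramDeriv a))) a := by
    refine hasStrictFDerivAt_pi'.2 fun i => ?_
    fin_cases i
    · exact hg 0 1
    · exact hg 0 2
    · exact hg 1 2
    · exact (hg 0 0).sub (hg 1 1)
    · exact (hg 1 1).sub (hg 2 2)
  exact (EuclideanSpace.equiv (Fin 5) ℝ).symm.hasStrictFDerivAt.comp a h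

lemma contDiff_casimir : ContDiff ℝ ∞ casimir := by
  have hg : ∀ i j, ContDiff ℝ ∞ fun b => (mat b * (mat b).transpose) i j := by
    intro i j
    simp only [Matrix.mul_apply, Matrix.transpose_apply]
    exact ContDiff.sum fun k _ => (entry i k).contDiff.mul (entry j k).contDiff
  refine (ContinuousLinearEquiv.contDiff _).comp (contDiff_pi.2 fun i => ?_)
  fin_cases i
  · exact hg 0 1
  · exact hg 0 2
  · exact hg 1 2
  · exact (hg 0 0).sub (hg 1 1)
  · exact (hg 1 1).sub (hg 2 2)

lemma casimirDeriv_eq_iff (a u : Su2Cubed) (v : EuclideanSpace ℝ (Fin 5)) :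
    casimirDeriv a u = v ↔ gramDeriv a 0 1 u = v 0 ∧ gramDeriv a 0 2 u = v 1 ∧
      gramDeriv a 1 2 u = v 2 ∧ gramDeriv a 0 0 u - gramDeriv a 1 1 u = v 3 ∧
      gramDeriv a 1 1 u - gramDeriv a 2 2 u = v 4 := by
  have h : casimirDeriv a u = v ↔ ∀ i, traceFree (gramDeriv a) i u = v i := by
    rw [PiLp.ext_iff]; rfl
  rw [h, Fin.forall_fin_succ, Fin.forall_fin_succ, Fin.forall_fin_succ, Fin.forall_fin_two]
  rfl

/-- The derivative reads W + Wᵀ modulo scalars. It vanishes exactly when W is scalar plus skew, and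
a skew 3 × 3 matrix is a cross product. -/
lemma casimirDeriv_eq_zero_iff (a u : Su2Cubed) :
    casimirDeriv a u = 0 ↔ ∃ x y, mat u * (mat a).transpose = quat x y := by
  simp only [casimirDeriv_eq_iff, gramDeriv_apply, PiLp.zero_apply]
  generalize mat u * (mat a).transpose = W
  constructor
  · rintro ⟨h0, h1, h2, h3, h4⟩
    refine ⟨W 0 0, ![W 2 1, W 0 2, W 1 0], ?_⟩
    ext i j
    fin_cases i <;> fin_cases j <;> simp [quat] <;> linarith
  · rintro ⟨x, y, rfl⟩
    simp [quat]

lemma casimirDeriv_surjective {a : Su2Cubed} (ha : (mat a).det ≠ 0) :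
    Function.Surjective (casimirDeriv a) := by
  intro v
  obtain ⟨u, hu⟩ := exists_mat_mul_transpose_eq ha
    !![(v 3 + v 4) / 2, v 0, v 1; 0, v 4 / 2, v 2; 0, 0, 0]
  refine ⟨u, (casimirDeriv_eq_iff a u v).2 ?_⟩
  simp only [gramDeriv_apply, hu]
  simp

lemma mem_symplecticDist_iff_casimirDeriv {κ : ℝ} (hκ : κ ≠ 0) {a u : Su2Cubed}
    (ha : (mat a).det ≠ 0) : u ∈ symplecticDist κ a ↔ casimirDeriv a u = 0 :=
  (mem_symplecticDist hκ ha).trans (casimirDeriv_eq_zero_iff a u).symm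

/-! ### Levels of the Casimir functions. -/

lemma continuous_det_mat : Continuous fun a => (mat a).det := by
  simp only [Matrix.det_fin_three, ← entry_apply]
  fun_prop

/-- The points on the same level of the Casimir functions and on the same side of `Φ = 0`. -/
def level (a : Su2Cubed) : Set Su2Cubed :=
  {b | casimir b = casimir a ∧ 0 < (mat b).det * (mat a).det}

lemma det_ne_zero_of_mem_level {a b : Su2Cubed} (h : b ∈ level a) : (mat b).det ≠ 0 :=
  left_ne_zero_of_mul h.2.ne'

lemma isIntegralSubmanifold_level {κ : ℝ} (hκ : κ ≠ 0) (a : Su2Cubed) :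
    IsIntegralSubmanifold κ (level a) := by
  intro p hp
  refine ⟨{b | 0 < (mat b).det * (mat a).det}, casimir,
    isOpen_lt continuous_const (continuous_det_mat.mul continuous_const), hp.2,
    contDiff_casimir.contDiffOn, ?_, ?_⟩
  · ext x
    simp only [level, Set.mem_inter_iff, Set.mem_ofPred_eq, hp.1]
    tauto
  · intro x hx
    have hx := det_ne_zero_of_mem_level hx.1
    rw [(hasStrictFDerivAt_casimir x).hasFDerivAt.fderiv]
    refine ⟨casimirDeriv_surjective hx, ?_⟩
    ext u
    exact (mem_symplecticDist_iff_casimirDeriv hκ hx).symm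

/-! ### Paths tangent to the distribution -/

/-- Along the path the Casimir functions have zero derivative, and the determinant, continuous and
never zero, keeps its sign. -/
lemma mem_level_of_tangentPath {κ : ℝ} (hκ : κ ≠ 0) {a b : Su2Cubed} (h : TangentPath κ a b) :
    b ∈ level a := by
  obtain ⟨γ, hγ, rfl, rfl, h⟩ := h
  have hstar : ∀ t ∈ Set.Icc (0 : ℝ) 1, (mat (γ t)).det ≠ 0 := fun t ht =>
    (mem_starSet hκ).1 (h t ht).1
  have hd : ∀ t ∈ Set.Icc (0 : ℝ) 1, HasDerivWithinAt (casimir ∘ γ) 0 (Set.Icc 0 1) t := by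
    intro t ht
    have h1 := (hγ.differentiableOn one_ne_zero t ht).hasDerivWithinAt
    have h2 := (hasStrictFDerivAt_casimir (γ t)).hasFDerivAt.comp_hasDerivWithinAt t h1
    exact h2.congr_deriv
      ((mem_symplecticDist_iff_casimirDeriv hκ (hstar t ht)).1 (h t ht).2)
  have h1 : (1 : ℝ) ∈ Set.Icc (0 : ℝ) 1 := by simp
  have h0 : (0 : ℝ) ∈ Set.Icc (0 : ℝ) 1 := by simp
  refine ⟨constant_of_derivWithin_zero (fun t ht => (hd t ht).differentiableWithinAt)
    (fun t ht => (hd t (Set.Ico_subset_Icc_self ht)).derivWithin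
      (uniqueDiffOn_Icc_zero_one t (Set.Ico_subset_Icc_self ht))) 1 h1, ?_⟩
  have hc : ContinuousOn (fun t => (mat (γ t)).det) (Set.Icc 0 1) :=
    continuous_det_mat.comp_continuousOn hγ.continuousOn
  by_contra hneg
  have hz : (0 : ℝ) ∈ Set.uIcc (mat (γ 0)).det (mat (γ 1)).det := by
    rw [Set.mem_uIcc]
    rcases lt_or_ge 0 (mat (γ 0)).det with h' | h'
    · exact Or.inr ⟨by by_contra h''; exact hneg (mul_pos (not_le.1 h'') h'), h'.le⟩
    · refine Or.inl ⟨h', ?_⟩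
      by_contra h''
      exact hneg (mul_pos_of_neg_of_neg (not_le.1 h'') (lt_of_le_of_ne h' (hstar 0 h0)))
  rw [← Set.uIcc_of_le zero_le_one] at hc
  obtain ⟨t, ht, hz⟩ := intermediate_value_uIcc hc hz
  rw [Set.uIcc_of_le zero_le_one] at ht
  exact hstar t ht hz

lemma tangentPath_of_casimir_eq {κ : ℝ} (hκ : κ ≠ 0) {γ : ℝ → Su2Cubed}
    (hγ : ContDiffOn ℝ 1 γ (Set.Icc 0 1)) (hdet : ∀ t ∈ Set.Icc (0 : ℝ) 1, (mat (γ t)).det ≠ 0)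
    (hcas : ∀ t ∈ Set.Icc (0 : ℝ) 1, casimir (γ t) = casimir (γ 0)) :
    TangentPath κ (γ 0) (γ 1) := by
  refine ⟨γ, hγ, rfl, rfl, fun t ht => ⟨(mem_starSet hκ).2 (hdet t ht), ?_⟩⟩
  rw [mem_symplecticDist_iff_casimirDeriv hκ (hdet t ht)]
  have h1 := (hγ.differentiableOn one_ne_zero t ht).hasDerivWithinAt
  have h2 := (hasStrictFDerivAt_casimir (γ t)).hasFDerivAt.comp_hasDerivWithinAt t h1
  have h3 : HasDerivWithinAt (casimir ∘ γ) 0 (Set.Icc 0 1) t :=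
    (hasDerivWithinAt_const t _ (casimir (γ 0))).congr hcas (hcas t ht)
  exact (uniqueDiffOn_Icc_zero_one t ht).eq_deriv _ h2 h3

lemma mem_level_refl {a : Su2Cubed} (ha : (mat a).det ≠ 0) : a ∈ level a :=
  ⟨rfl, mul_self_pos.2 ha⟩

lemma mem_level_trans {a b c : Su2Cubed} (hab : b ∈ level a) (hbc : c ∈ level b) :
    c ∈ level a := by
  refine ⟨hbc.1.trans hab.1, ?_⟩
  have h := mul_pos hbc.2 hab.2
  have h' : 0 < (mat b).det ^ 2 := sq_pos_of_ne_zero (det_ne_zero_of_mem_level hab)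
  by_contra h''
  nlinarith

lemma leafThrough_subset_level {κ : ℝ} (hκ : κ ≠ 0) {a : Su2Cubed} (ha : (mat a).det ≠ 0) :
    leafThrough κ a ⊆ level a := by
  intro b hb
  induction hb with
  | refl => exact mem_level_refl ha
  | tail _ h ih => exact mem_level_trans ih (mem_level_of_tangentPath hκ h)

/-! ### Orthogonal matrices -/

/-- A real symmetric matrix is diagonalised by an orthogonal matrix of prescribed determinant, with
decreasing eigenvalues. -/
lemma exists_orthogonal_diagonal {S : Matrix (Fin 3) (Fin 3) ℝ} (hS : S.transpose = S) {ε : ℝ}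
    (hε : ε = 1 ∨ ε = -1) : ∃ (O : Matrix (Fin 3) (Fin 3) ℝ) (μ : Fin 3 → ℝ),
      O.transpose * O = 1 ∧ O.det = ε ∧ Antitone μ ∧ S = O * Matrix.diagonal μ * O.transpose := by
  have hH : S.IsHermitian := by
    rwa [Matrix.IsHermitian, Matrix.conjTranspose_eq_transpose_of_trivial]
  let V : Matrix (Fin 3) (Fin 3) ℝ := hH.eigenvectorUnitary
  have hV : V.transpose * V = 1 := by
    have := (Matrix.mem_unitaryGroup_iff').1 hH.eigenvectorUnitary.2
    rwa [Matrix.star_eq_conjTranspose, Matrix.conjTranspose_eq_transpose_of_trivial] at this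
  have hspec : S = V * Matrix.diagonal hH.eigenvalues * V.transpose := by
    have := hH.spectral_theorem
    rw [Unitary.conjStarAlgAut_apply] at this
    rwa [Matrix.star_eq_conjTranspose, Matrix.conjTranspose_eq_transpose_of_trivial] at this
  -- Sorting the negatives puts the eigenvalues in decreasing order.
  let σ := Tuple.sort (fun i => -hH.eigenvalues i)
  let W := V.submatrix id σ
  have hW : W.transpose * W = 1 := by
    have : W.transpose * W = (V.transpose * V).submatrix σ σ := by
      ext i j; simp [W, Matrix.mul_apply]
    rw [this, hV, Matrix.submatrix_one_equiv]
  have hWs : S = W * Matrix.diagonal (hH.eigenvalues ∘ σ) * W.transpose := by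
    ext i j
    conv_lhs => rw [hspec]
    rw [Matrix.mul_apply, Matrix.mul_apply]
    simp only [Matrix.mul_diagonal, Matrix.transpose_apply, W, Matrix.submatrix_apply, id,
      Function.comp]
    exact (Equiv.sum_comp σ fun k => V i k * hH.eigenvalues k * V j k).symm
  have hdet : W.det * W.det = 1 := by
    rw [← Matrix.det_one (n := Fin 3) (R := ℝ), ← hW, Matrix.det_mul, Matrix.det_transpose]
  have hc : (ε * W.det) * (ε * W.det) = 1 := by rcases hε with rfl | rfl <;> linarith
  -- The sign ε·det W on the first column makes the determinant ε(det W)² = ε. The diagonalisation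
  -- sees only its square.
  refine ⟨W * Matrix.diagonal ![ε * W.det, 1, 1], hH.eigenvalues ∘ σ, ?_, ?_, ?_, ?_⟩
  · rw [Matrix.transpose_mul, Matrix.mul_assoc, ← Matrix.mul_assoc W.transpose, hW, Matrix.one_mul,
      Matrix.diagonal_transpose, Matrix.diagonal_mul_diagonal, ← Matrix.diagonal_one]
    congr 1
    ext i; fin_cases i <;> simp [hc]
  · rw [Matrix.det_mul, Matrix.det_diagonal, Fin.prod_univ_three]
    simp only [Matrix.cons_val, mul_one]
    linear_combination ε * hdet
  · have := Tuple.monotone_sort (fun i => -hH.eigenvalues i)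
    intro i j hij
    exact neg_le_neg_iff.1 (this hij)
  · rw [Matrix.transpose_mul, Matrix.diagonal_transpose]
    conv_lhs => rw [hWs]
    simp only [Matrix.mul_assoc]
    rw [← Matrix.mul_assoc (Matrix.diagonal (hH.eigenvalues ∘ σ)), ← Matrix.mul_assoc,
      Matrix.diagonal_mul_diagonal, ← Matrix.mul_assoc (Matrix.diagonal ![ε * W.det, 1, 1]),
      Matrix.diagonal_mul_diagonal, ← Matrix.mul_assoc]
    congr 3
    ext i; fin_cases i <;> simp
    linear_combination (-hH.eigenvalues (σ 0)) * hc

/-! ### Rotations and Euler angles. -/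

lemma det_sq_of_orthogonal {R : Matrix (Fin 3) (Fin 3) ℝ} (h : R * R.transpose = 1) :
    R.det ^ 2 = 1 := by
  rw [← Matrix.det_one (n := Fin 3) (R := ℝ), ← h, Matrix.det_mul, Matrix.det_transpose, sq]

/-- Rotation about the third axis. -/
def rotZ (θ : ℝ) : Matrix (Fin 3) (Fin 3) ℝ :=
  !![Real.cos θ, Real.sin θ, 0; -Real.sin θ, Real.cos θ, 0; 0, 0, 1]

/-- Rotation about the second axis. -/
def rotY (θ : ℝ) : Matrix (Fin 3) (Fin 3) ℝ :=
  !![Real.cos θ, 0, Real.sin θ; 0, 1, 0; -Real.sin θ, 0, Real.cos θ]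

/-- Rotation about the first axis. -/
def rotX (θ : ℝ) : Matrix (Fin 3) (Fin 3) ℝ :=
  !![1, 0, 0; 0, Real.cos θ, Real.sin θ; 0, -Real.sin θ, Real.cos θ]

lemma rotZ_mul_transpose (θ : ℝ) : rotZ θ * (rotZ θ).transpose = 1 := by
  have h := Real.sin_sq_add_cos_sq θ
  ext i j; fin_cases i <;> fin_cases j <;> simp [rotZ, Matrix.mul_apply, Fin.sum_univ_three] <;>
    linarith

lemma rotY_mul_transpose (θ : ℝ) : rotY θ * (rotY θ).transpose = 1 := by
  have h := Real.sin_sq_add_cos_sq θ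
  ext i j; fin_cases i <;> fin_cases j <;> simp [rotY, Matrix.mul_apply, Fin.sum_univ_three] <;>
    linarith

lemma rotX_mul_transpose (θ : ℝ) : rotX θ * (rotX θ).transpose = 1 := by
  have h := Real.sin_sq_add_cos_sq θ
  ext i j; fin_cases i <;> fin_cases j <;> simp [rotX, Matrix.mul_apply, Fin.sum_univ_three] <;>
    linarith

/-- Rotating the vector (x, y) by minus its argument brings it to the nonnegative first axis. -/
lemma exists_angle (x y : ℝ) :
    ∃ θ, x * Real.sin θ + y * Real.cos θ = 0 ∧ 0 ≤ x * Real.cos θ - y * Real.sin θ := by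
  refine ⟨-Complex.arg ⟨x, y⟩, ?_⟩
  have h1 : _ = x := Complex.norm_mul_cos_arg ⟨x, y⟩
  have h2 : _ = y := Complex.norm_mul_sin_arg ⟨x, y⟩
  have h3 := norm_nonneg (⟨x, y⟩ : ℂ)
  have h4 := Real.sin_sq_add_cos_sq (Complex.arg ⟨x, y⟩)
  rw [Real.sin_neg, Real.cos_neg]
  generalize Complex.arg ⟨x, y⟩ = θ at *
  generalize ‖(⟨x, y⟩ : ℂ)‖ = r at *
  subst h1 h2
  refine ⟨by ring, ?_⟩
  have : r * Real.cos θ * Real.cos θ - r * Real.sin θ * -Real.sin θ = r := by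
    linear_combination r * h4
  rwa [this]

lemma mul_orthogonal {R T : Matrix (Fin 3) (Fin 3) ℝ} (hR : R * R.transpose = 1)
    (hT : T * T.transpose = 1) : (R * T) * (R * T).transpose = 1 := by
  rw [Matrix.transpose_mul, Matrix.mul_assoc, ← Matrix.mul_assoc T, hT, Matrix.one_mul, hR]

lemma det_rot (θ : ℝ) : (rotX θ).det = 1 ∧ (rotY θ).det = 1 ∧ (rotZ θ).det = 1 := by
  have h := Real.sin_sq_add_cos_sq θ
  refine ⟨?_, ?_, ?_⟩ <;> simp [Matrix.det_fin_three, rotX, rotY, rotZ] <;> linarith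

lemma row_sq_of_orthogonal {T : Matrix (Fin 3) (Fin 3) ℝ} (h : T * T.transpose = 1) (i : Fin 3) :
    T i 0 ^ 2 + T i 1 ^ 2 + T i 2 ^ 2 = 1 := by
  have := congrFun (congrFun h i) i
  simp only [Matrix.mul_apply, Fin.sum_univ_three, Matrix.transpose_apply,
    Matrix.one_apply_eq] at this
  linarith

lemma col_sq_of_orthogonal {T : Matrix (Fin 3) (Fin 3) ℝ} (h : T * T.transpose = 1) (i : Fin 3) :
    T 0 i ^ 2 + T 1 i ^ 2 + T 2 i ^ 2 = 1 :=
  row_sq_of_orthogonal (T := T.transpose) (mul_eq_one_comm.1 h) i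

/-- Unit rows and columns with the sign conditions force the entries one after another; the
determinant fixes the last sign. -/
lemma eq_one_of_orthogonal_lower {U : Matrix (Fin 3) (Fin 3) ℝ} (hU : U * U.transpose = 1)
    (hUd : U.det = 1) (h01 : U 0 1 = 0) (h02 : U 0 2 = 0) (h12 : U 1 2 = 0) (hp0 : 0 ≤ U 0 0)
    (hp1 : 0 ≤ U 1 1) : U = 1 := by
  have h00 : U 0 0 = 1 := by
    have := row_sq_of_orthogonal hU 0
    rw [h01, h02] at this
    exact (pow_eq_one_iff_of_nonneg hp0 two_ne_zero).1 (by linarith)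
  have hc0 := col_sq_of_orthogonal hU 0
  rw [h00] at hc0
  have h10 : U 1 0 = 0 := pow_eq_zero_iff two_ne_zero |>.1
    (by linarith [sq_nonneg (U 1 0), sq_nonneg (U 2 0)])
  have h20 : U 2 0 = 0 := pow_eq_zero_iff two_ne_zero |>.1
    (by linarith [sq_nonneg (U 1 0), sq_nonneg (U 2 0)])
  have h11 : U 1 1 = 1 := by
    have := row_sq_of_orthogonal hU 1
    rw [h10, h12] at this
    exact (pow_eq_one_iff_of_nonneg hp1 two_ne_zero).1 (by linarith)
  have hc1 := col_sq_of_orthogonal hU 1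
  rw [h01, h11] at hc1
  have h21 : U 2 1 = 0 := pow_eq_zero_iff two_ne_zero |>.1 (by linarith)
  have h22 : U 2 2 = 1 := by
    rw [Matrix.det_fin_three, h00, h10, h20, h11, h21, h01, h02, h12] at hUd
    linarith
  ext i j
  fin_cases i <;> fin_cases j <;> simp [h00, h01, h02, h10, h11, h12, h20, h21, h22]

/-- Euler angles. -/
lemma exists_rot_eq_one {R : Matrix (Fin 3) (Fin 3) ℝ} (hR : R * R.transpose = 1)
    (hdet : R.det = 1) : ∃ α β γ, R * rotZ α * rotY β * rotX γ = 1 := by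
  -- Only the zero at (0, 1) is needed here, since β secures the sign at (0, 0). The later rotations
  -- keep this zero: β does not touch column 1, and γ mixes columns 1 and 2 once both vanish in row
  -- 0.
  obtain ⟨α, hα, -⟩ := exists_angle (R 0 0) (R 0 1)
  have hS := mul_orthogonal hR (rotZ_mul_transpose α)
  have hSd : (R * rotZ α).det = 1 := by rw [Matrix.det_mul, hdet, (det_rot α).2.2, one_mul]
  have hS01 : (R * rotZ α) 0 1 = 0 := by
    simpa [Matrix.mul_apply, Fin.sum_univ_three, rotZ] using hα
  generalize hRS : R * rotZ α = S at *
  obtain ⟨β, hβ, hβ'⟩ := exists_angle (S 0 0) (S 0 2)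
  have hT := mul_orthogonal hS (rotY_mul_transpose β)
  have hTd : (S * rotY β).det = 1 := by rw [Matrix.det_mul, hSd, (det_rot β).2.1, one_mul]
  have hT01 : (S * rotY β) 0 1 = 0 := by
    simpa [Matrix.mul_apply, Fin.sum_univ_three, rotY] using hS01
  have hT02 : (S * rotY β) 0 2 = 0 := by
    simpa [Matrix.mul_apply, Fin.sum_univ_three, rotY] using hβ
  have hT00 : 0 ≤ (S * rotY β) 0 0 := by
    simp [Matrix.mul_apply, Fin.sum_univ_three, rotY]; linarith
  generalize hST : S * rotY β = T at *
  obtain ⟨γ, hγ, hγ'⟩ := exists_angle (T 1 1) (T 1 2)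
  have hU := mul_orthogonal hT (rotX_mul_transpose γ)
  have hUd : (T * rotX γ).det = 1 := by rw [Matrix.det_mul, hTd, (det_rot γ).1, one_mul]
  have hU00 : 0 ≤ (T * rotX γ) 0 0 := by
    simpa [Matrix.mul_apply, Fin.sum_univ_three, rotX] using hT00
  have hU01 : (T * rotX γ) 0 1 = 0 := by
    simp [Matrix.mul_apply, Fin.sum_univ_three, rotX, hT01, hT02]
  have hU02 : (T * rotX γ) 0 2 = 0 := by
    simp [Matrix.mul_apply, Fin.sum_univ_three, rotX, hT01, hT02]
  have hU12 : (T * rotX γ) 1 2 = 0 := by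
    simpa [Matrix.mul_apply, Fin.sum_univ_three, rotX] using hγ
  have hU11 : 0 ≤ (T * rotX γ) 1 1 := by
    simp [Matrix.mul_apply, Fin.sum_univ_three, rotX]; linarith
  refine ⟨α, β, γ, ?_⟩
  rw [hRS, hST]
  exact eq_one_of_orthogonal_lower hU hUd hU01 hU02 hU12 hU00 hU11

/-! ### Leaves are levels -/

lemma contDiffOn_mat_symm {M : ℝ → Matrix (Fin 3) (Fin 3) ℝ} {s : Set ℝ}
    (h : ∀ i j, ContDiffOn ℝ 1 (fun t => M t i j) s) :
    ContDiffOn ℝ 1 (fun t => mat.symm (M t)) s := by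
  let e : (Fin 3 → Fin 3 → ℝ) →L[ℝ] Su2Cubed := LinearMap.toContinuousLinearMap
    (mat.symm.toLinearMap : (Fin 3 → Fin 3 → ℝ) →ₗ[ℝ] Su2Cubed)
  exact e.contDiff.comp_contDiffOn (contDiffOn_pi.2 fun i => contDiffOn_pi.2 fun j => h i j)

lemma tangentPath_of_matrix {κ : ℝ} (hκ : κ ≠ 0) {a b : Su2Cubed}
    {M : ℝ → Matrix (Fin 3) (Fin 3) ℝ} (h : ∀ i j, ContDiffOn ℝ 1 (fun t => M t i j) (Set.Icc 0 1))
    (h0 : M 0 = mat a) (h1 : M 1 = mat b) (hdet : ∀ t ∈ Set.Icc (0 : ℝ) 1, (M t).det ≠ 0)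
    (hgram : ∀ t ∈ Set.Icc (0 : ℝ) 1, ∃ s : ℝ,
      M t * (M t).transpose = mat a * (mat a).transpose + s • 1) : TangentPath κ a b := by
  have := tangentPath_of_casimir_eq hκ (contDiffOn_mat_symm h)
    (fun t ht => by rw [LinearEquiv.apply_symm_apply]; exact hdet t ht)
    (fun t ht => by
      rw [casimir_eq_iff, LinearEquiv.apply_symm_apply, LinearEquiv.apply_symm_apply, h0]
      exact hgram t ht)
  rwa [h0, h1, LinearEquiv.symm_apply_apply, LinearEquiv.symm_apply_apply] at this

/-- Right multiplication by an orthogonal matrix leaves aaᵀ unchanged. -/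
lemma tangentPath_of_rotation {κ : ℝ} (hκ : κ ≠ 0) {a b : Su2Cubed} (ha : (mat a).det ≠ 0)
    {R : ℝ → Matrix (Fin 3) (Fin 3) ℝ} (h : ∀ i j, ContDiff ℝ 1 fun t => R t i j)
    (h0 : R 0 = 1) (hR : ∀ t, R t * (R t).transpose = 1) (θ : ℝ) (hb : mat b = mat a * R θ) :
    TangentPath κ a b := by
  refine tangentPath_of_matrix hκ (M := fun t => mat a * R (t * θ)) (fun i j => ?_) ?_ ?_ ?_ ?_
  · simp only [Matrix.mul_apply]
    exact (ContDiff.sum fun k _ => contDiff_const.mul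
      ((h k j).comp (contDiff_id.mul contDiff_const))).contDiffOn
  · simp [h0]
  · simp [hb]
  · intro t _
    rw [Matrix.det_mul]
    have := det_sq_of_orthogonal (hR (t * θ))
    exact mul_ne_zero ha fun h => by simp [h] at this
  · intro t _
    refine ⟨0, ?_⟩
    rw [Matrix.transpose_mul, Matrix.mul_assoc, ← Matrix.mul_assoc (R _), hR, Matrix.one_mul,
      zero_smul, add_zero]

lemma tangentPath_rot {κ : ℝ} (hκ : κ ≠ 0) {a b : Su2Cubed} (ha : (mat a).det ≠ 0) (θ : ℝ)
    (hb : mat b = mat a * rotX θ ∨ mat b = mat a * rotY θ ∨ mat b = mat a * rotZ θ) :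
    TangentPath κ a b := by
  rcases hb with hb | hb | hb
  · refine tangentPath_of_rotation hκ ha (R := rotX) ?_ ?_ rotX_mul_transpose θ hb
    · intro i j
      fin_cases i <;> fin_cases j <;> simp [rotX] <;> fun_prop
    · ext i j; fin_cases i <;> fin_cases j <;> simp [rotX]
  · refine tangentPath_of_rotation hκ ha (R := rotY) ?_ ?_ rotY_mul_transpose θ hb
    · intro i j
      fin_cases i <;> fin_cases j <;> simp [rotY] <;> fun_prop
    · ext i j; fin_cases i <;> fin_cases j <;> simp [rotY]
  · refine tangentPath_of_rotation hκ ha (R := rotZ) ?_ ?_ rotZ_mul_transpose θ hb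
    · intro i j
      fin_cases i <;> fin_cases j <;> simp [rotZ] <;> fun_prop
    · ext i j; fin_cases i <;> fin_cases j <;> simp [rotZ]

/-- Equal Gram matrices make b⁻¹a orthogonal and equal signs make its determinant 1. Its Euler
angles give three consecutive tangent paths from a to b. -/
lemma mem_leafThrough_of_gram_eq {κ : ℝ} (hκ : κ ≠ 0) {a b : Su2Cubed}
    (hgram : mat b * (mat b).transpose = mat a * (mat a).transpose)
    (hdet : 0 < (mat b).det * (mat a).det) : b ∈ leafThrough κ a := by
  have ha : (mat a).det ≠ 0 := right_ne_zero_of_mul hdet.ne'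
  have hb : (mat b).det ≠ 0 := left_ne_zero_of_mul hdet.ne'
  have hb' : IsUnit (mat b).det := hb.isUnit
  have hR : ((mat b)⁻¹ * mat a) * ((mat b)⁻¹ * mat a).transpose = 1 := by
    rw [Matrix.transpose_mul, Matrix.mul_assoc, ← Matrix.mul_assoc (mat a), ← hgram,
      Matrix.transpose_nonsing_inv, Matrix.mul_nonsing_inv_cancel_right _ _
        (by rwa [Matrix.det_transpose]), Matrix.nonsing_inv_mul _ hb']
  have hRd : ((mat b)⁻¹ * mat a).det = 1 := by
    have hsq := det_sq_of_orthogonal hR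
    have hpos : 0 < ((mat b)⁻¹ * mat a).det := by
      have h1 : (mat b).det * ((mat b)⁻¹ * mat a).det = (mat a).det := by
        rw [← Matrix.det_mul, ← Matrix.mul_assoc, Matrix.mul_nonsing_inv _ hb', Matrix.one_mul]
      rw [← h1, ← mul_assoc] at hdet
      exact pos_of_mul_pos_right hdet (mul_self_nonneg _)
    nlinarith
  obtain ⟨α, β, γ, h⟩ := exists_rot_eq_one hR hRd
  have h' : mat b = mat a * rotZ α * rotY β * rotX γ := by
    have := congrArg (mat b * ·) h
    simp only [mul_one, ← mul_assoc, Matrix.mul_nonsing_inv _ hb', one_mul] at this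
    exact this.symm
  have h1 : (mat (mat.symm (mat a * rotZ α))).det ≠ 0 := by
    rwa [LinearEquiv.apply_symm_apply, Matrix.det_mul, (det_rot α).2.2, mul_one]
  have h2 : (mat (mat.symm (mat a * rotZ α * rotY β))).det ≠ 0 := by
    rwa [LinearEquiv.apply_symm_apply, Matrix.det_mul, Matrix.det_mul, (det_rot α).2.2,
      (det_rot β).2.1, mul_one, mul_one]
  refine ((Relation.ReflTransGen.single (tangentPath_rot hκ ha α (b := mat.symm (mat a * rotZ α))
    ?_)).tail (tangentPath_rot hκ h1 β (b := mat.symm (mat a * rotZ α * rotY β)) ?_)).tail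
    (tangentPath_rot hκ h2 γ ?_)
  · simp
  · simp
  · left; rw [h', LinearEquiv.apply_symm_apply]

lemma mul_transpose_self_diag_pos {A : Matrix (Fin 3) (Fin 3) ℝ} (hA : A.det ≠ 0) (i : Fin 3) :
    0 < (A * A.transpose) i i := by
  by_contra h
  have h' : A i = 0 := by
    rw [← dotProduct_self_eq_zero]
    refine le_antisymm (not_lt.1 h) ?_
    exact Finset.sum_nonneg fun k _ => mul_self_nonneg _
  exact hA (Matrix.det_eq_zero_of_row_eq_zero i fun j => congrFun h' j)

/-- In an eigenbasis of aaᵀ, rescaling a from the left by √((μᵢ + ts)/μᵢ) shifts the Gram matrix by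
ts. At t = 1 it reaches that of b. -/
lemma exists_tangentPath_gram_eq {κ : ℝ} (hκ : κ ≠ 0) {a b : Su2Cubed} (hb : b ∈ level a) :
    ∃ c, TangentPath κ a c ∧ mat b * (mat b).transpose = mat c * (mat c).transpose ∧
      0 < (mat b).det * (mat c).det := by
  obtain ⟨s, hs⟩ := casimir_eq_iff.1 hb.1
  have ha : (mat a).det ≠ 0 := right_ne_zero_of_mul hb.2.ne'
  have hb' : (mat b).det ≠ 0 := left_ne_zero_of_mul hb.2.ne'
  obtain ⟨O, μ, hO, hOd, -, hS⟩ := exists_orthogonal_diagonal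
    (S := mat a * (mat a).transpose) (by simp [Matrix.transpose_mul]) (Or.inl rfl)
  have hO' : O * O.transpose = 1 := mul_eq_one_comm.1 hO
  have conj : ∀ {C : Matrix (Fin 3) (Fin 3) ℝ} {ν : Fin 3 → ℝ}, C.det ≠ 0 →
      C * C.transpose = O * Matrix.diagonal ν * O.transpose → ∀ i, 0 < ν i := by
    intro C ν hC h i
    have h1 : (O.transpose * C) * (O.transpose * C).transpose = Matrix.diagonal ν := by
      rw [Matrix.transpose_mul, Matrix.transpose_transpose, Matrix.mul_assoc,
        ← Matrix.mul_assoc C, h, Matrix.mul_assoc, hO, Matrix.mul_one, ← Matrix.mul_assoc,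
        hO, Matrix.one_mul]
    have h2 := mul_transpose_self_diag_pos (A := O.transpose * C)
      (by rwa [Matrix.det_mul, Matrix.det_transpose, hOd, one_mul]) i
    rwa [h1, Matrix.diagonal_apply_eq] at h2
  have hshift : ∀ t : ℝ, O * Matrix.diagonal (fun i => μ i + t) * O.transpose =
      mat a * (mat a).transpose + t • 1 := by
    intro t
    have : Matrix.diagonal (fun i => μ i + t) = Matrix.diagonal μ + t • 1 := by
      rw [← Matrix.diagonal_one, ← Matrix.diagonal_smul, Matrix.diagonal_add]
      simp
    rw [this, Matrix.mul_add, Matrix.add_mul, ← hS, Matrix.mul_smul, Matrix.smul_mul,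
      Matrix.mul_one, hO']
  have hμ : ∀ i, 0 < μ i := conj ha hS
  have hμs : ∀ i, 0 < μ i + s := conj hb' (hs.trans (hshift s).symm)
  -- μᵢ + ts is a convex combination of the eigenvalues μᵢ of aaᵀ and μᵢ + s of bbᵀ, all positive
  -- since a and b are invertible.
  have hpos : ∀ t ∈ Set.Icc (0 : ℝ) 1, ∀ i, 0 < (μ i + t * s) / μ i := by
    intro t ht i
    refine div_pos ?_ (hμ i)
    have : μ i + t * s = (1 - t) * μ i + t * (μ i + s) := by ring
    rw [this]
    rcases eq_or_lt_of_le ht.1 with h | h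
    · simp [← h, hμ i]
    · have := mul_pos h (hμs i)
      have := mul_nonneg (sub_nonneg.2 ht.2) (hμ i).le
      linarith
  let D : ℝ → Matrix (Fin 3) (Fin 3) ℝ := fun t =>
    Matrix.diagonal fun i => Real.sqrt ((μ i + t * s) / μ i)
  let M : ℝ → Matrix (Fin 3) (Fin 3) ℝ := fun t => O * D t * (O.transpose * mat a)
  have hMdet : ∀ t, (M t).det = (∏ i, Real.sqrt ((μ i + t * s) / μ i)) * (mat a).det := by
    intro t
    simp only [M, D, Matrix.det_mul, Matrix.det_transpose, hOd, Matrix.det_diagonal, one_mul]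
  have hprod : ∀ t ∈ Set.Icc (0 : ℝ) 1, 0 < ∏ i, Real.sqrt ((μ i + t * s) / μ i) :=
    fun t ht => Finset.prod_pos fun i _ => Real.sqrt_pos.2 (hpos t ht i)
  have hgram : ∀ t ∈ Set.Icc (0 : ℝ) 1,
      M t * (M t).transpose = mat a * (mat a).transpose + (t * s) • 1 := by
    intro t ht
    have h1 : M t * (M t).transpose =
        O * (D t * (O.transpose * (mat a * (mat a).transpose) * O) * D t) * O.transpose := by
      simp only [M, Matrix.transpose_mul, Matrix.transpose_transpose, Matrix.mul_assoc, D,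
        Matrix.diagonal_transpose]
    have h2 : O.transpose * (mat a * (mat a).transpose) * O = Matrix.diagonal μ := by
      rw [hS, Matrix.mul_assoc, Matrix.mul_assoc, hO, Matrix.mul_one, ← Matrix.mul_assoc, hO,
        Matrix.one_mul]
    rw [h1, h2, ← hshift]
    simp only [D, Matrix.diagonal_mul_diagonal]
    congr 3
    ext i
    have h3 := Real.mul_self_sqrt (hpos t ht i).le
    have h4 := (hμ i).ne'
    calc _ = Real.sqrt ((μ i + t * s) / μ i) * Real.sqrt ((μ i + t * s) / μ i) * μ i := by ring
      _ = _ := by rw [h3]; field_simp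
  have hone : (1 : ℝ) ∈ Set.Icc (0 : ℝ) 1 := by simp
  refine ⟨mat.symm (M 1), tangentPath_of_matrix hκ (M := M) ?_ ?_ ?_ ?_ ?_, ?_, ?_⟩
  · intro i j
    simp only [M, D, Matrix.mul_apply (N := O.transpose * mat a), Matrix.mul_diagonal]
    refine ContDiffOn.sum fun k _ => (contDiffOn_const.mul ?_).mul contDiffOn_const
    refine ContDiffOn.sqrt ?_ fun t ht => (hpos t ht k).ne'
    fun_prop
  · have : D 0 = 1 := by
      simp only [D, zero_mul, add_zero, div_self (hμ _).ne', Real.sqrt_one, Matrix.diagonal_one]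
    simp only [M, this, Matrix.mul_one]
    rw [← Matrix.mul_assoc, hO', Matrix.one_mul]
  · simp
  · intro t ht
    rw [hMdet]
    exact mul_ne_zero (hprod t ht).ne' ha
  · exact fun t ht => ⟨_, hgram t ht⟩
  · rw [LinearEquiv.apply_symm_apply, hgram 1 hone, hs, one_mul]
  · rw [LinearEquiv.apply_symm_apply, hMdet, mul_left_comm]
    exact mul_pos (hprod 1 hone) hb.2

theorem leafThrough_eq_level {κ : ℝ} (hκ : κ ≠ 0) {a : Su2Cubed} (ha : (mat a).det ≠ 0) :
    leafThrough κ a = level a := by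
  refine (leafThrough_subset_level hκ ha).antisymm fun b hb => ?_
  obtain ⟨c, hac, hgram, hdet⟩ := exists_tangentPath_gram_eq hκ hb
  exact (Relation.ReflTransGen.single hac).trans (mem_leafThrough_of_gram_eq hκ hgram hdet)

/-! ### The action of `O(3)` on triples -/

/-- The linear map `a ↦ a O` which replaces `aⱼ` by `∑ᵢ Oᵢⱼ aᵢ`. -/
def mix (O : Matrix (Fin 3) (Fin 3) ℝ) : Su2Cubed →L[ℝ] Su2Cubed :=
  LinearMap.toContinuousLinearMap
    (mat.symm.toLinearMap ∘ₗ LinearMap.mulLeft ℝ O.transpose ∘ₗ mat.toLinearMap)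

lemma mat_mix (O : Matrix (Fin 3) (Fin 3) ℝ) (a : Su2Cubed) :
    mat (mix O a) = O.transpose * mat a :=
  LinearEquiv.apply_symm_apply mat (O.transpose * mat a)

lemma det_mat_mix (O : Matrix (Fin 3) (Fin 3) ℝ) (a : Su2Cubed) :
    (mat (mix O a)).det = O.det * (mat a).det := by
  rw [mat_mix, Matrix.det_mul, Matrix.det_transpose]

lemma mix_transpose_mix {O : Matrix (Fin 3) (Fin 3) ℝ} (hO : O.transpose * O = 1) (a : Su2Cubed) :
    mix O.transpose (mix O a) = a := by
  apply mat.injective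
  rw [mat_mix, mat_mix, Matrix.transpose_transpose, ← Matrix.mul_assoc, mul_eq_one_comm.1 hO,
    Matrix.one_mul]

lemma mix_mem_level {O : Matrix (Fin 3) (Fin 3) ℝ} (hO : O.transpose * O = 1) {a b : Su2Cubed}
    (hb : b ∈ level a) : mix O b ∈ level (mix O a) := by
  obtain ⟨s, hs⟩ := casimir_eq_iff.1 hb.1
  refine ⟨casimir_eq_iff.2 ⟨s, ?_⟩, ?_⟩
  · have h : ∀ c, mat (mix O c) * (mat (mix O c)).transpose =
        O.transpose * (mat c * (mat c).transpose) * O := by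
      intro c
      rw [mat_mix, Matrix.transpose_mul, Matrix.transpose_transpose]
      simp only [Matrix.mul_assoc]
    rw [h, h, hs, Matrix.mul_add, Matrix.add_mul, Matrix.mul_smul, Matrix.mul_one, Matrix.smul_mul,
      hO]
  · have hsq : O.det ^ 2 = 1 := det_sq_of_orthogonal (mul_eq_one_comm.1 hO)
    rw [det_mat_mix, det_mat_mix]
    have h := hb.2
    calc 0 < (mat b).det * (mat a).det := h
      _ = _ := by linear_combination (-(mat b).det * (mat a).det) * hsq

lemma adjugate_of_orthogonal {O : Matrix (Fin 3) (Fin 3) ℝ} (hO : O.transpose * O = 1) :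
    O.adjugate = O.det • O.transpose := by
  have h := congrArg (· * O.transpose) (Matrix.adjugate_mul O)
  simpa only [Matrix.mul_assoc, mul_eq_one_comm.1 hO, Matrix.mul_one, Matrix.smul_mul,
    Matrix.one_mul] using h

/-- The identity Oᵀ[y]×O = [adj(O)y]× is polynomial and holds for every O. Orthogonality serves only
the scalar part. -/
lemma transpose_mul_quat_mul {O : Matrix (Fin 3) (Fin 3) ℝ} (hO : O.transpose * O = 1) (x : ℝ)
    (y : Fin 3 → ℝ) :
    O.transpose * quat x y * O = quat x (O.adjugate.mulVec y) := by
  have h1 : ∀ w, quat x w = x • 1 + quat 0 w := by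
    intro w
    ext i j; fin_cases i <;> fin_cases j <;> simp [quat]
  have h2 : O.transpose * quat 0 y * O = quat 0 (O.adjugate.mulVec y) := by
    rw [Matrix.adjugate_fin_three]
    ext i j
    fin_cases i <;> fin_cases j <;>
      simp [quat, Matrix.mul_apply, Fin.sum_univ_three, Matrix.mulVec, dotProduct] <;> ring
  rw [h1 y, h1 (O.adjugate.mulVec y), Matrix.mul_add, Matrix.add_mul, h2, Matrix.mul_smul,
    Matrix.mul_one, Matrix.smul_mul, hO]

lemma mat_mix_mul_transpose {O : Matrix (Fin 3) (Fin 3) ℝ} (hO : O.transpose * O = 1)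
    {a u : Su2Cubed} {x : ℝ} {y : Fin 3 → ℝ} (hu : mat u * (mat a).transpose = quat x y) :
    mat (mix O u) * (mat (mix O a)).transpose = quat x (O.adjugate.mulVec y) := by
  rw [← transpose_mul_quat_mul hO, ← hu, mat_mix, mat_mix, Matrix.transpose_mul,
    Matrix.transpose_transpose]
  simp only [Matrix.mul_assoc]

/-- The terms linear in y and y′ pick up adj(O) = det O · Oᵀ. The cross product picks up the same,
because Oᵀy × Oᵀy′ = adj(O)(y × y′) and (det O)² = 1. -/
lemma omegaQuat_adjugate {O : Matrix (Fin 3) (Fin 3) ℝ} (hO : O.transpose * O = 1) (x x' : ℝ)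
    (y y' : Fin 3 → ℝ) (j : Fin 3) :
    omegaQuat j x (O.adjugate.mulVec y) x' (O.adjugate.mulVec y') =
      O.det * ∑ i, omegaQuat i x y x' y' * O i j := by
  have hsq : O.det ^ 2 = 1 := det_sq_of_orthogonal (mul_eq_one_comm.1 hO)
  have hadj := adjugate_of_orthogonal hO
  have hcross : ∀ j, (O.transpose.mulVec y) (j + 1) * (O.transpose.mulVec y') (j + 2) -
      (O.transpose.mulVec y) (j + 2) * (O.transpose.mulVec y') (j + 1) =
      O.adjugate.mulVec (fun i => y (i + 1) * y' (i + 2) - y (i + 2) * y' (i + 1)) j := by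
    intro j
    rw [Matrix.adjugate_fin_three]
    fin_cases j <;> simp [Fin.sum_univ_three, Matrix.mulVec, dotProduct] <;> ring
  have hc := hcross j
  rw [hadj, Matrix.smul_mulVec, Pi.smul_apply, smul_eq_mul] at hc
  have hO' : ∀ w : Fin 3 → ℝ, O.transpose.mulVec w j = w 0 * O 0 j + w 1 * O 1 j + w 2 * O 2 j := by
    intro w
    simp only [Matrix.mulVec, dotProduct, Fin.sum_univ_three, Matrix.transpose_apply]
    ring
  rw [hadj, Matrix.smul_mulVec, Matrix.smul_mulVec]
  simp only [omegaQuat, Pi.smul_apply, smul_eq_mul, Fin.sum_univ_three]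
  have e1 : (1 + 1 : Fin 3) = 2 := rfl
  have e2 : (1 + 2 : Fin 3) = 0 := rfl
  have e3 : (2 + 1 : Fin 3) = 0 := rfl
  have e4 : (2 + 2 : Fin 3) = 1 := rfl
  rw [hO'] at hc
  rw [hO', hO']
  simp only [zero_add, e1, e2, e3, e4] at hc ⊢
  linear_combination O.det ^ 2 * hc + O.det * (y 1 * y' 2 - y 2 * y' 1) * O 0 j * hsq +
    O.det * (y 2 * y' 0 - y 0 * y' 2) * O 1 j * hsq +
    O.det * (y 0 * y' 1 - y 1 * y' 0) * O 2 j * hsq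

/-- On tangent vectors, the derivative of a smooth extension of the restriction of a linear map to a
level is that linear map. -/
lemma fderiv_eq_of_isLocalExtension {κ : ℝ} (hκ : κ ≠ 0) {a : Su2Cubed} {F : level a → Su2Cubed}
    {T : Su2Cubed →L[ℝ] Su2Cubed} (hF : ∀ x, F x = T x) {p : level a} {G : Su2Cubed → Su2Cubed}
    (hG : IsLocalExtension (level a) F p G) {u : Su2Cubed} (hu : u ∈ symplecticDist κ p) :
    fderiv ℝ G p u = T u := by
  have hp := det_ne_zero_of_mem_level p.2
  have hG' : HasStrictFDerivAt G (fderiv ℝ G p) (p : Su2Cubed) :=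
    hG.1.hasStrictFDerivAt (by simp)
  have hnear : ∀ᶠ x in 𝓝 (p : Su2Cubed), casimir x = casimir p → G x = T x := by
    have hopen : ∀ᶠ x in 𝓝 (p : Su2Cubed), 0 < (mat x).det * (mat a).det :=
      (continuous_det_mat.mul continuous_const).continuousAt.eventually (lt_mem_nhds p.2.2)
    filter_upwards [hopen, hG.2] with x hx hGx hc
    rw [hGx ⟨hc.trans p.2.1, hx⟩, hF]
  have key : ∀ i j, entry i j (fderiv ℝ G p u - T u) = 0 := by
    intro i j
    have hφ : HasStrictFDerivAt (fun x => entry i j (G x - T x))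
        (entry i j ∘L (fderiv ℝ G p - T)) (p : Su2Cubed) :=
      (entry i j).hasStrictFDerivAt.comp (p : Su2Cubed) (hG'.sub T.hasStrictFDerivAt)
    -- Lagrange multipliers: each entry of G − T is constant on the Casimir fibre near p, so p is
    -- trivially an extremum. Surjectivity of `casimirDeriv` excludes Λ₀ = 0, so the derivative
    -- vanishes on the kernel.
    have hextr : IsLocalExtrOn (fun x => entry i j (G x - T x)) {x | casimir x = casimir p}
        (p : Su2Cubed) := by
      left
      filter_upwards [self_mem_nhdsWithin, nhdsWithin_le_nhds hnear] with x hx hGx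
      rw [hGx hx, hnear.self_of_nhds rfl, sub_self, sub_self]
    obtain ⟨Λ, Λ₀, hne, h⟩ := hextr.exists_linear_map_of_hasStrictFDerivAt
      (hasStrictFDerivAt_casimir p) hφ
    have hu' := (mem_symplecticDist_iff_casimirDeriv hκ hp).1 hu
    have hΛ : Λ (casimirDeriv p u) = 0 := (congrArg Λ hu').trans (map_zero Λ)
    have h0 : Λ (casimirDeriv p u) + Λ₀ * entry i j (fderiv ℝ G p u - T u) = 0 := h u
    rw [hΛ, zero_add, mul_eq_zero] at h0
    rcases h0 with h0 | h0
    · exfalso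
      apply hne
      rw [Prod.mk_eq_zero]
      refine ⟨LinearMap.ext fun v => ?_, h0⟩
      obtain ⟨w, rfl⟩ := casimirDeriv_surjective hp v
      have hw : Λ (casimirDeriv p w) + Λ₀ * entry i j (fderiv ℝ G p w - T w) = 0 := h w
      rwa [h0, zero_mul, add_zero] at hw
    · exact h0
  rw [← sub_eq_zero]
  apply mat.injective
  rw [map_zero]
  exact Matrix.ext key

lemma exists_isIsomorphismVia {κ : ℝ} (hκ : κ ≠ 0) (a : Su2Cubed)
    {O : Matrix (Fin 3) (Fin 3) ℝ} (hO : O.transpose * O = 1) :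
    ∃ F : level a ≃ level (mix O a), IsIsomorphismVia κ (level a) (level (mix O a)) F O := by
  have hO' : O.transpose.transpose * O.transpose = 1 := by
    rw [Matrix.transpose_transpose]; exact mul_eq_one_comm.1 hO
  have hinv : ∀ y, mix O (mix O.transpose y) = y := by
    intro y
    simpa only [Matrix.transpose_transpose] using mix_transpose_mix hO' y
  let F : level a ≃ level (mix O a) :=
    { toFun := fun x => ⟨mix O x, mix_mem_level hO x.2⟩
      invFun := fun y => ⟨mix O.transpose y, by
        have := mix_mem_level hO' y.2
        rwa [mix_transpose_mix hO] at this⟩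
      left_inv := fun x => Subtype.ext (mix_transpose_mix hO x)
      right_inv := fun y => Subtype.ext (hinv y) }
  have hF : ∀ x, (F x : Su2Cubed) = mix O x := fun x => rfl
  refine ⟨F, ?_, ?_, ?_, ?_⟩
  · exact fun p => ⟨mix O, (mix O).contDiff.contDiffAt, Filter.Eventually.of_forall fun _ _ => rfl⟩
  · exact fun p => ⟨mix O.transpose, (mix O.transpose).contDiff.contDiffAt,
      Filter.Eventually.of_forall fun _ _ => rfl⟩
  · intro p G hG u hu
    rw [fderiv_eq_of_isLocalExtension hκ hF hG hu]
    obtain ⟨x, y, h⟩ := (mem_symplecticDist hκ (det_ne_zero_of_mem_level p.2)).1 hu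
    exact (mem_symplecticDist hκ (det_ne_zero_of_mem_level (F p).2)).2
      ⟨_, _, mat_mix_mul_transpose hO h⟩
  · intro p G hG u hu v hv j
    rw [fderiv_eq_of_isLocalExtension hκ hF hG hu, fderiv_eq_of_isLocalExtension hκ hF hG hv]
    have hp := det_ne_zero_of_mem_level p.2
    obtain ⟨x, y, h⟩ := (mem_symplecticDist hκ hp).1 hu
    obtain ⟨x', y', h'⟩ := (mem_symplecticDist hκ hp).1 hv
    have hdet : O.det⁻¹ * O.det = 1 :=
      inv_mul_cancel₀ fun h0 => by
        simpa [h0] using det_sq_of_orthogonal (mul_eq_one_comm.1 hO)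
    have hFp : (mat (mix O p)).det ≠ 0 := det_ne_zero_of_mem_level (F p).2
    rw [hF, omega_eq hκ j hFp (mat_mix_mul_transpose hO h)
      (mat_mix_mul_transpose hO h'), omegaQuat_adjugate hO, det_mat_mix, mul_inv]
    simp only [omega_eq hκ _ hp h h', Fin.sum_univ_three]
    linear_combination (2 * κ * (mat (p : Su2Cubed)).det⁻¹ * (omegaQuat 0 x y x' y' * O 0 j +
      omegaQuat 1 x y x' y' * O 1 j + omegaQuat 2 x y x' y' * O 2 j)) * hdet

/-! ### Normal forms -/

lemma mem_normalForm {κ q r : ℝ} (hκ : κ ≠ 0) {a : Su2Cubed} : a ∈ normalForm κ q r ↔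
    0 < κ * (mat a).det ∧ ∃ μ : Fin 3 → ℝ, mat a * (mat a).transpose = Matrix.diagonal μ ∧
      -2 * κ * (μ 0 - μ 1) = q ∧ -2 * κ * (μ 1 - μ 2) = r := by
  have hPhi : ip κ (a 0) ⁅a 1, a 2⁆ = -2 * κ * (mat a).det := Phi_eq κ a
  constructor
  · rintro ⟨-, h1, h2, h3, h4⟩
    rw [hPhi] at h1
    simp only [ip_apply] at h2 h3 h4
    refine ⟨by linarith, fun i => (mat a * (mat a).transpose) i i, ?_, by linarith, by linarith⟩
    ext i j
    by_cases hij : i = j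
    · simp [hij]
    · rw [Matrix.diagonal_apply_ne _ hij]
      simpa [hκ] using h2 i j hij
  · rintro ⟨h1, μ, h2, h3, h4⟩
    refine ⟨(mem_starSet hκ).2 (right_ne_zero_of_mul h1.ne'), by rw [hPhi]; linarith,
      fun i j hij => ?_, ?_, ?_⟩
    · rw [ip_apply, h2, Matrix.diagonal_apply_ne _ hij, mul_zero]
    · rw [ip_apply, ip_apply, h2, Matrix.diagonal_apply_eq, Matrix.diagonal_apply_eq]
      linarith
    · rw [ip_apply, ip_apply, h2, Matrix.diagonal_apply_eq, Matrix.diagonal_apply_eq]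
      linarith

/-- Diagonal matrices with the same consecutive differences differ by a scalar, and Φ < 0 fixes the
side. -/
lemma normalForm_eq_level {κ q r : ℝ} (hκ : κ ≠ 0) {a : Su2Cubed} (ha : a ∈ normalForm κ q r) :
    normalForm κ q r = level a := by
  obtain ⟨h1, μ, h2, h3, h4⟩ := (mem_normalForm hκ).1 ha
  have hc : -2 * κ ≠ 0 := by simpa using hκ
  ext b
  rw [mem_normalForm hκ]
  constructor
  · rintro ⟨h1', ν, h2', h3', h4'⟩
    refine ⟨casimir_eq_iff.2 ⟨ν 0 - μ 0, ?_⟩, ?_⟩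
    · rw [h2, h2', ← Matrix.diagonal_one, ← Matrix.diagonal_smul, Matrix.diagonal_add]
      have e1 := mul_left_cancel₀ hc (h3.trans h3'.symm)
      have e2 := mul_left_cancel₀ hc (h4.trans h4'.symm)
      congr 1
      ext i
      fin_cases i <;> simp <;> linarith
    · have hpos := mul_pos h1' h1
      have : 0 < κ ^ 2 * ((mat b).det * (mat a).det) := by
        calc _ < _ := hpos
          _ = _ := by ring
      exact pos_of_mul_pos_right this (sq_nonneg κ)
  · intro hb
    obtain ⟨s, hs⟩ := casimir_eq_iff.1 hb.1
    refine ⟨?_, fun i => μ i + s, ?_, ?_, ?_⟩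
    · have := mul_pos hb.2 h1
      have : 0 < κ * (mat b).det * (mat a).det ^ 2 := by
        calc _ < _ := this
          _ = _ := by ring
      exact pos_of_mul_pos_left this (sq_nonneg _)
    · rw [hs, h2, ← Matrix.diagonal_one, ← Matrix.diagonal_smul, Matrix.diagonal_add]
      simp
    · rw [← h3]; ring
    · rw [← h4]; ring

lemma normalForm_nonempty {κ : ℝ} (hκ : κ ≠ 0) (q r : ℝ) : (normalForm κ q r).Nonempty := by
  let c := -2 * κ
  have hc : c ≠ 0 := by simpa [c] using hκ
  -- The differences are dictated by q and r; the common summand makes every entry positive.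
  let μ : Fin 3 → ℝ := ![1 + |r / c| + |(q + r) / c| + (q + r) / c,
    1 + |r / c| + |(q + r) / c| + r / c, 1 + |r / c| + |(q + r) / c|]
  have hμ : ∀ i, 0 < μ i := by
    have h1 := neg_abs_le (r / c)
    have h2 := neg_abs_le ((q + r) / c)
    have h3 := abs_nonneg (r / c)
    have h4 := abs_nonneg ((q + r) / c)
    intro i
    fin_cases i <;> simp [μ] <;> linarith
  -- The sign κ/|κ| makes κ det positive without changing the Gram matrix.
  let d : Fin 3 → ℝ := ![κ / |κ| * Real.sqrt (μ 0), Real.sqrt (μ 1), Real.sqrt (μ 2)]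
  have hκ' : 0 < |κ| := abs_pos.2 hκ
  refine ⟨mat.symm (Matrix.diagonal d), (mem_normalForm hκ).2 ⟨?_, μ, ?_, ?_, ?_⟩⟩
  · rw [LinearEquiv.apply_symm_apply, Matrix.det_diagonal, Fin.prod_univ_three]
    have h : κ * (d 0 * d 1 * d 2) =
        κ ^ 2 / |κ| * (Real.sqrt (μ 0) * Real.sqrt (μ 1) * Real.sqrt (μ 2)) := by
      simp only [d, Matrix.cons_val]; ring
    rw [h]
    have h0 := Real.sqrt_pos.2 (hμ 0)
    have h1 := Real.sqrt_pos.2 (hμ 1)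
    have h2 := Real.sqrt_pos.2 (hμ 2)
    positivity
  · rw [LinearEquiv.apply_symm_apply, Matrix.diagonal_transpose, Matrix.diagonal_mul_diagonal]
    congr 1
    have hs : κ / |κ| * (κ / |κ|) = 1 := by
      rw [div_mul_div_comm, abs_mul_abs_self, div_self (mul_self_ne_zero.2 hκ)]
    ext i
    have h := Real.mul_self_sqrt (hμ i).le
    fin_cases i
    · calc κ / |κ| * Real.sqrt (μ 0) * (κ / |κ| * Real.sqrt (μ 0)) =
          κ / |κ| * (κ / |κ|) * (Real.sqrt (μ 0) * Real.sqrt (μ 0)) := by ring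
        _ = μ 0 := by rw [hs, one_mul]; exact h
    · exact h
    · exact h
  · change c * (μ 0 - μ 1) = q
    simp only [μ, Matrix.cons_val]
    field_simp
    ring
  · change c * (μ 1 - μ 2) = r
    simp only [μ, Matrix.cons_val]
    field_simp
    ring

/-- Diagonalising −2κ aaᵀ instead of aaᵀ makes decreasing eigenvalues yield q, r ≥ 0 for either sign
of κ. -/
lemma exists_mix_mem_normalForm {κ : ℝ} (hκ : κ ≠ 0) {a : Su2Cubed} {ε : ℝ} (hε : ε = 1 ∨ ε = -1)
    (ha : 0 < κ * (ε * (mat a).det)) : ∃ (O : Matrix (Fin 3) (Fin 3) ℝ) (q r : ℝ),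
      O.transpose * O = 1 ∧ O.det = ε ∧ 0 ≤ q ∧ 0 ≤ r ∧ mix O a ∈ normalForm κ q r := by
  obtain ⟨O, μ, hO, hOd, hμ, hS⟩ := exists_orthogonal_diagonal
    (S := (-2 * κ) • (mat a * (mat a).transpose)) (by simp [Matrix.transpose_mul]) hε
  have hc : -2 * κ ≠ 0 := by simpa using hκ
  refine ⟨O, μ 0 - μ 1, μ 1 - μ 2, hO, hOd, sub_nonneg.2 (hμ (by decide)),
    sub_nonneg.2 (hμ (by decide)), (mem_normalForm hκ).2
      ⟨by rwa [det_mat_mix, hOd], fun i => (-2 * κ)⁻¹ * μ i, ?_, ?_, ?_⟩⟩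
  · have h : mat a * (mat a).transpose = (-2 * κ)⁻¹ • (O * Matrix.diagonal μ * O.transpose) := by
      rw [← hS, smul_smul, inv_mul_cancel₀ hc, one_smul]
    have hd : Matrix.diagonal (fun i => (-2 * κ)⁻¹ * μ i) = (-2 * κ)⁻¹ • Matrix.diagonal μ := by
      rw [← Matrix.diagonal_smul]; rfl
    rw [mat_mix, Matrix.transpose_mul, Matrix.transpose_transpose, Matrix.mul_assoc,
      ← Matrix.mul_assoc (mat a), h, Matrix.smul_mul, Matrix.mul_smul, Matrix.mul_assoc, hO,
      Matrix.mul_one, ← Matrix.mul_assoc, hO, Matrix.one_mul, hd]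
  · field_simp
    ring
  · field_simp
    ring

lemma exists_isomorphism_normalForm {κ : ℝ} (hκ : κ ≠ 0) {a : Su2Cubed} {ε : ℝ}
    (hε : ε = 1 ∨ ε = -1) (ha : 0 < κ * (ε * (mat a).det)) :
    ∃ q r : ℝ, 0 ≤ q ∧ 0 ≤ r ∧ ∃ (F : level a ≃ normalForm κ q r) (O : Matrix (Fin 3) (Fin 3) ℝ),
      O ∈ Matrix.orthogonalGroup (Fin 3) ℝ ∧ O.det = ε ∧
        IsIsomorphismVia κ (level a) (normalForm κ q r) F O := by
  obtain ⟨O, q, r, hO, hOd, hq, hr, hN⟩ := exists_mix_mem_normalForm hκ hε ha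
  refine ⟨q, r, hq, hr, ?_⟩
  rw [normalForm_eq_level hκ hN]
  obtain ⟨F, hF⟩ := exists_isIsomorphismVia hκ a hO
  exact ⟨F, O, (Matrix.mem_orthogonalGroup_iff' _ _).2 hO, hOd, hF⟩

/-! ### The sign of the metric -/

lemma exists_pos_metric_self_eq {κ : ℝ} (hκ : κ ≠ 0) {a u : Su2Cubed} (ha : (mat a).det ≠ 0)
    (hu : u ∈ symplecticDist κ a) (hu0 : u ≠ 0) :
    ∃ s > 0, metric κ a u u = κ * (mat a).det * s := by
  obtain ⟨x, y, h⟩ := (mem_symplecticDist hκ ha).1 hu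
  have hpos : 0 < x ^ 2 + y 0 ^ 2 + y 1 ^ 2 + y 2 ^ 2 := by
    by_contra hneg
    have hx : x = 0 := pow_eq_zero_iff two_ne_zero |>.1
      (by linarith [sq_nonneg x, sq_nonneg (y 0), sq_nonneg (y 1), sq_nonneg (y 2)])
    have h0 : y 0 = 0 := pow_eq_zero_iff two_ne_zero |>.1
      (by linarith [sq_nonneg x, sq_nonneg (y 0), sq_nonneg (y 1), sq_nonneg (y 2)])
    have h1 : y 1 = 0 := pow_eq_zero_iff two_ne_zero |>.1
      (by linarith [sq_nonneg x, sq_nonneg (y 0), sq_nonneg (y 1), sq_nonneg (y 2)])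
    have h2 : y 2 = 0 := pow_eq_zero_iff two_ne_zero |>.1
      (by linarith [sq_nonneg x, sq_nonneg (y 0), sq_nonneg (y 1), sq_nonneg (y 2)])
    have hq : quat x y = 0 := by
      ext i j; fin_cases i <;> fin_cases j <;> simp [quat, hx, h0, h1, h2]
    rw [hq] at h
    apply hu0
    apply mat.injective
    rw [map_zero, ← Matrix.mul_nonsing_inv_cancel_right (A := (mat a).transpose) (mat u)
      (by rwa [Matrix.det_transpose, isUnit_iff_ne_zero]), h, Matrix.zero_mul]
  refine ⟨2 * ((mat a).det ^ 2)⁻¹ * (x ^ 2 + y 0 ^ 2 + y 1 ^ 2 + y 2 ^ 2), by positivity, ?_⟩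
  rw [metric_self_eq hκ ha h]
  field_simp

lemma exists_ne_zero_mem_symplecticDist {κ : ℝ} (hκ : κ ≠ 0) {a : Su2Cubed}
    (ha : (mat a).det ≠ 0) : ∃ u ∈ symplecticDist κ a, u ≠ 0 := by
  obtain ⟨u, hu⟩ := exists_mat_mul_transpose_eq ha (quat 1 0)
  refine ⟨u, (mem_symplecticDist hκ ha).2 ⟨_, _, hu⟩, ?_⟩
  rintro rfl
  have := congrFun (congrFun hu 0) 0
  simp [quat] at this

lemma mem_negSet {κ : ℝ} {a : Su2Cubed} : a ∈ negSet κ ↔ 0 < κ * (mat a).det := by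
  rw [negSet, Set.mem_ofPred_eq, Phi_eq]
  constructor <;> intro h <;> linarith

lemma mem_posSet {κ : ℝ} {a : Su2Cubed} : a ∈ posSet κ ↔ κ * (mat a).det < 0 := by
  rw [posSet, Set.mem_ofPred_eq, Phi_eq]
  constructor <;> intro h <;> linarith

lemma mul_det_pos_of_mem_level {κ : ℝ} {a b : Su2Cubed} (hb : b ∈ level a) :
    (0 < κ * (mat a).det → 0 < κ * (mat b).det) ∧
      (κ * (mat a).det < 0 → κ * (mat b).det < 0) := by
  have ha : (mat a).det ≠ 0 := right_ne_zero_of_mul hb.2.ne'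
  have hsq : 0 < (mat a).det ^ 2 := sq_pos_of_ne_zero ha
  have e : κ * (mat b).det * (mat a).det ^ 2 =
    κ * (mat a).det * ((mat b).det * (mat a).det) := by ring
  constructor
  · intro h
    refine pos_of_mul_pos_left (b := (mat a).det ^ 2) ?_ hsq.le
    rw [e]
    exact mul_pos h hb.2
  · intro h
    by_contra h'
    have := mul_nonneg (not_lt.1 h') hsq.le
    rw [e] at this
    exact absurd (mul_neg_of_neg_of_pos h hb.2) (not_lt.2 this)

lemma metric_level {κ : ℝ} (hκ : κ ≠ 0) {a : Su2Cubed} (ha : (mat a).det ≠ 0) :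
    (level a ⊆ negSet κ ∨ level a ⊆ posSet κ) ∧
      (MetricPosDef κ (level a) ↔ level a ⊆ negSet κ) ∧
      (MetricNegDef κ (level a) ↔ level a ⊆ posSet κ) := by
  have hneg : level a ⊆ negSet κ → MetricPosDef κ (level a) := by
    intro h b hb u hu hu0
    obtain ⟨s, hs, e⟩ := exists_pos_metric_self_eq hκ (det_ne_zero_of_mem_level hb) hu hu0
    rw [e]
    exact mul_pos (mem_negSet.1 (h hb)) hs
  have hpos : level a ⊆ posSet κ → MetricNegDef κ (level a) := by
    intro h b hb u hu hu0
    obtain ⟨s, hs, e⟩ := exists_pos_metric_self_eq hκ (det_ne_zero_of_mem_level hb) hu hu0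
    rw [e]
    exact mul_neg_of_neg_of_pos (mem_posSet.1 (h hb)) hs
  have hdich : level a ⊆ negSet κ ∨ level a ⊆ posSet κ := by
    rcases lt_or_gt_of_ne (mul_ne_zero hκ ha) with h | h
    · exact Or.inr fun b hb => mem_posSet.2 ((mul_det_pos_of_mem_level hb).2 h)
    · exact Or.inl fun b hb => mem_negSet.2 ((mul_det_pos_of_mem_level hb).1 h)
  -- 𝒟 contains a nonzero vector, so the two definiteness conditions are not both vacuous.
  have hexcl : ¬(MetricPosDef κ (level a) ∧ MetricNegDef κ (level a)) := by
    rintro ⟨h1, h2⟩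
    obtain ⟨u, hu, hu0⟩ := exists_ne_zero_mem_symplecticDist hκ ha
    exact lt_asymm (h1 a (mem_level_refl ha) u hu hu0) (h2 a (mem_level_refl ha) u hu hu0)
  refine ⟨hdich, ⟨fun h => ?_, hneg⟩, ⟨fun h => ?_, hpos⟩⟩
  · exact hdich.resolve_right fun h' => hexcl ⟨h, hpos h'⟩
  · exact hdich.resolve_left fun h' => hexcl ⟨hneg h', h⟩

end HyperLie

end

theorem theorem3p9 (κ : ℝ) (hκ : κ ≠ 0) :
    (∀ q r : ℝ, 0 ≤ q → 0 ≤ r →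
      HyperLie.IsLeaf κ (HyperLie.normalForm κ q r) ∧
      HyperLie.IsIntegralSubmanifold κ (HyperLie.normalForm κ q r)) ∧
    ∀ L : Set HyperLie.Su2Cubed, HyperLie.IsLeaf κ L →
      HyperLie.IsIntegralSubmanifold κ L ∧
      (L ⊆ HyperLie.negSet κ ∨ L ⊆ HyperLie.posSet κ) ∧
      (HyperLie.MetricPosDef κ L ↔ L ⊆ HyperLie.negSet κ) ∧
      (HyperLie.MetricNegDef κ L ↔ L ⊆ HyperLie.posSet κ) ∧
      (HyperLie.MetricPosDef κ L →
        ∃ q r : ℝ, 0 ≤ q ∧ 0 ≤ r ∧ HyperLie.Isomorphic κ L (HyperLie.normalForm κ q r)) ∧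
      (HyperLie.MetricNegDef κ L →
        ∃ q r : ℝ, 0 ≤ q ∧ 0 ≤ r ∧ HyperLie.AntiIsomorphic κ L (HyperLie.normalForm κ q r)) := by
  refine ⟨fun q r _ _ => ?_, ?_⟩
  · obtain ⟨a, ha⟩ := HyperLie.normalForm_nonempty hκ q r
    have hdet := (HyperLie.mem_starSet hκ).1 ha.1
    rw [HyperLie.normalForm_eq_level hκ ha]
    exact ⟨⟨a, ha.1, (HyperLie.leafThrough_eq_level hκ hdet).symm⟩,
      HyperLie.isIntegralSubmanifold_level hκ a⟩
  · rintro L ⟨a, ha, rfl⟩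
    have hdet := (HyperLie.mem_starSet hκ).1 ha
    rw [HyperLie.leafThrough_eq_level hκ hdet]
    obtain ⟨hdich, hneg, hpos⟩ := HyperLie.metric_level hκ hdet
    have ha' := HyperLie.mem_level_refl hdet
    refine ⟨HyperLie.isIntegralSubmanifold_level hκ a, hdich, hneg, hpos, fun h => ?_, fun h => ?_⟩
    · exact HyperLie.exists_isomorphism_normalForm hκ (Or.inl rfl)
        (by rw [one_mul]; exact HyperLie.mem_negSet.1 (hneg.1 h ha'))
    -- N_{q,r} lies in Φ < 0, so a leaf with Φ > 0 reaches it by determinant −1.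
    · exact HyperLie.exists_isomorphism_normalForm hκ (Or.inr rfl)
        (by linarith [HyperLie.mem_posSet.1 (hpos.1 h ha')])
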